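/- Let $\mathbb H$ be the hyperbolic plane of curvature $-1$, let $o\in\mathbb H$, and let $X=L^2([0,1],\mathbb H)$ be the space of a.e.-classes of measurable maps $x\colon[0,1]\to\mathbb H$ with $\int_{[0,1]} d(o,x_t)^2\,dt<\infty$, with the distance $d(x,y)=\left(\int_{[0,1]}d(x_t,y_t)^2\,dt\right)^{1/2}$. For a point $x$ of a metric space, the space of directions $\Sigma_x$ is the set of geodesic rays starting at $x$, two rays being identified if their Alexandrov angle vanishes, with the Alexandrov angle as metric; the tangent cone $T_x$ is the Euclidean cone over $\Sigma_x$. For a separable metric space $Y$ of diameter at most $\pi$, the integral join $\int^*_{[0,1]}Y$ is the set of pairs $(y,v)$ of measurable maps $y\colon[0,1]\to Y$, $v\colon[0,1]\to[0,\infty)$ with $\int_{[0,1]} v_t^2\,dt=1$, with the metric $d\in[0,\pi]$ given by $\cos d((y,v),(z,w))=\int_{[0,1]} v_tw_t\cos d(y_t,z_t)\,dt$, where pairs at distance $0$ are identified. A CAT(0) symmetric space is a complete CAT(0) space in which every point $x$ is the unique fixed point of some involutive isometry. A CAT(0) space has bounded curvature if for every point $p$ there are $\rho,\mu>0$ such that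 $|\overline\angle_x(y,z)-\overline\angle_x(y',z')|\le\mu\,S_{x,y,z}$ for all distinct $x,y,z\in B(p,\rho)$, $y'\in\,]x,y]$, $z'\in\,]x,z]$, where $\overline\angle$ denotes comparison angles in the Euclidean plane and $S_{x,y,z}$ the area of the Euclidean comparison triangle. Then: 1. $X$ is a CAT(0) symmetric space. 2. For every $x\in X$, the space of directions $\Sigma_x$ is isometric to $\int^*_{[0,1]}\Sigma_o$. 3. For every $x\in X$, the tangent cone $T_x$ is isometric to $L^2([0,1],T_o)$, the space of a.e.-classes of measurable maps from $[0,1]$ to $T_o$ with square integrable distance to the apex, with the $L^2$ distance. This is a Hilbert space: there is an isometry of $T_o$ onto the Euclidean plane $\mathbb R^2$ that sends the apex to $0$, and applying it pointwise gives an isometry of $L^2([0,1],T_o)$ onto the Hilbert space $L^2([0,1],\mathbb R^2)$. 4. $X$ does not have bounded curvature. 5. $X$ is not a Riemannian manifold: it is not isometric to any smooth Riemannian manifold modelled on a real Hilbert space (with its Riemannian distance). -/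

import Mathlib

open MeasureTheory Filter Topology
open scoped Manifold ContDiff NNReal Bundle

noncomputable section

namespace PythInt

/-! ### Planar trigonometry -/

/-- Length of the third side of a planar Euclidean triangle with two sides of lengths `s`, `t`
enclosing the angle `θ`. -/
def eucSide (s t θ : ℝ) : ℝ := √(s ^ 2 + t ^ 2 - 2 * s * t * Real.cos θ)

def polar (s a : ℝ) : ℂ := ⟨s * Real.cos a, s * Real.sin a⟩

lemma norm_polar {s : ℝ} (hs : 0 ≤ s) (a : ℝ) : ‖polar s a‖ = s := by
  rw [Complex.norm_eq_sqrt_sq_add_sq]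
  simp only [polar]
  rw [show (s * Real.cos a) ^ 2 + (s * Real.sin a) ^ 2 = s ^ 2 by
    linear_combination s ^ 2 * Real.sin_sq_add_cos_sq a]
  exact Real.sqrt_sq hs

lemma norm_polar_sub (s t a b : ℝ) : ‖polar s a - polar t b‖ = eucSide s t (a - b) := by
  rw [Complex.norm_eq_sqrt_sq_add_sq, eucSide]
  congr 1
  simp only [polar, Complex.sub_re, Complex.sub_im]
  rw [Real.cos_sub]
  linear_combination s ^ 2 * Real.sin_sq_add_cos_sq a + t ^ 2 * Real.sin_sq_add_cos_sq b

lemma eucSide_arg_nonneg (s t θ : ℝ) : 0 ≤ s ^ 2 + t ^ 2 - 2 * s * t * Real.cos θ := by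
  nlinarith [sq_nonneg (s - t * Real.cos θ), Real.sin_sq_add_cos_sq θ,
    sq_nonneg (t * Real.sin θ)]

lemma eucSide_sq (s t θ : ℝ) :
    eucSide s t θ ^ 2 = s ^ 2 + t ^ 2 - 2 * s * t * Real.cos θ :=
  Real.sq_sqrt (eucSide_arg_nonneg s t θ)

lemma eucSide_nonneg (s t θ : ℝ) : 0 ≤ eucSide s t θ := Real.sqrt_nonneg _

lemma eucSide_comm (s t θ : ℝ) : eucSide s t θ = eucSide t s θ := by
  unfold eucSide; congr 1; ring

lemma eucSide_self_zero (s : ℝ) : eucSide s s 0 = 0 := by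
  simp [eucSide]; ring_nf; simp

lemma eucSide_zero_right {s : ℝ} (hs : 0 ≤ s) (θ : ℝ) : eucSide s 0 θ = s := by
  simp [eucSide, Real.sqrt_sq hs]

lemma eucSide_pi {s t : ℝ} (hs : 0 ≤ s) (ht : 0 ≤ t) : eucSide s t Real.pi = s + t := by
  rw [eucSide, Real.cos_pi, show s ^ 2 + t ^ 2 - 2 * s * t * -1 = (s + t) ^ 2 by ring]
  exact Real.sqrt_sq (by positivity)

lemma eucSide_tri (s t r a b : ℝ) : eucSide s r (a + b) ≤ eucSide s t a + eucSide t r b := by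
  have h := norm_sub_le_norm_sub_add_norm_sub (polar s a) (polar t 0) (polar r (-b))
  rw [norm_polar_sub, norm_polar_sub, norm_polar_sub] at h
  simpa using h

lemma eucSide_mono {s t a b : ℝ} (hs : 0 ≤ s) (ht : 0 ≤ t) (ha : 0 ≤ a) (hab : a ≤ b)
    (hb : b ≤ Real.pi) : eucSide s t a ≤ eucSide s t b := by
  apply Real.sqrt_le_sqrt
  have := Real.cos_le_cos_of_nonneg_of_le_pi ha hb hab
  nlinarith [mul_nonneg hs ht]

lemma angle_le_of_eucSide_le {s t a b : ℝ} (hs : 0 < s) (ht : 0 < t) (hb : 0 ≤ b)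
    (ha : a ≤ Real.pi) (h : eucSide s t a ≤ eucSide s t b) : a ≤ b := by
  by_contra! hlt
  have hc := Real.cos_lt_cos_of_nonneg_of_le_pi hb ha hlt
  have h2 := pow_le_pow_left₀ (eucSide_nonneg s t a) h 2
  rw [eucSide_sq, eucSide_sq] at h2
  nlinarith [mul_pos hs ht]

/-- Triangle inequality for Euclidean cones. -/
lemma eucSide_cone_tri {s t r a b c : ℝ} (hs : 0 ≤ s) (ht : 0 ≤ t) (hr : 0 ≤ r)
    (ha' : a ≤ Real.pi) (hb' : b ≤ Real.pi)
    (hc : 0 ≤ c) (hc' : c ≤ Real.pi) (h : c ≤ a + b) :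
    eucSide s r c ≤ eucSide s t a + eucSide t r b := by
  rcases le_total (a + b) Real.pi with hab | hab
  · exact (eucSide_mono hs hr hc h hab).trans (eucSide_tri s t r a b)
  · have h1 := eucSide_tri s t r a (Real.pi - a)
    have h2 : eucSide t r (Real.pi - a) ≤ eucSide t r b :=
      eucSide_mono ht hr (by linarith) (by linarith) hb'
    have h3 : eucSide s r c ≤ eucSide s r Real.pi := eucSide_mono hs hr hc hc' le_rfl
    rw [show a + (Real.pi - a) = Real.pi by ring] at h1
    linarith

/-- The common side of two adjacent planar triangles whose free vertices are joined by a
segment. -/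
lemma eucSide_split {s r a b : ℝ} (hs : 0 < s) (hr : 0 < r) (ha : 0 < a) (hb : 0 < b)
    (hab : a + b < Real.pi) :
    ∃ t : ℝ, 0 < t ∧ t ≤ max s r ∧ eucSide s t a + eucSide t r b = eucSide s r (a + b) := by
  have hsa : 0 < Real.sin a := Real.sin_pos_of_pos_of_lt_pi ha (by linarith)
  have hsb : 0 < Real.sin b := Real.sin_pos_of_pos_of_lt_pi hb (by linarith)
  have hsab : 0 < Real.sin (a + b) := Real.sin_pos_of_pos_of_lt_pi (by linarith) hab
  set D := s * Real.sin a + r * Real.sin b with hD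
  have hDpos : 0 < D := by positivity
  set w := r * Real.sin b / D with hw
  have hw0 : 0 ≤ w := by positivity
  have hw1 : 0 ≤ 1 - w := by
    have : 1 - w = s * Real.sin a / D := by rw [hw]; field_simp; rw [hD]; ring
    rw [this]; positivity
  set t := s * r * Real.sin (a + b) / D with ht
  have htpos : 0 < t := by positivity
  have key : polar t 0 = (w : ℂ) * polar s a + ((1 - w : ℝ) : ℂ) * polar r (-b) := by
    apply Complex.ext
    · simp only [polar, Complex.add_re, Complex.mul_re, Complex.ofReal_re, Complex.ofReal_im,
        Real.cos_zero, Real.cos_neg]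
      rw [ht, hw, Real.sin_add]
      field_simp
      rw [hD]; ring
    · simp only [polar, Complex.add_im, Complex.mul_im, Complex.ofReal_re, Complex.ofReal_im,
        Real.sin_zero, Real.sin_neg]
      rw [hw]
      field_simp
      rw [hD]; ring
  refine ⟨t, htpos, ?_, ?_⟩
  · have h1 : ‖polar t 0‖ ≤ w * s + (1 - w) * r := by
      rw [key]
      refine (norm_add_le _ _).trans ?_
      rw [norm_mul, norm_mul, norm_polar hs.le, norm_polar hr.le, Complex.norm_real,
        Complex.norm_real, Real.norm_of_nonneg hw0, Real.norm_of_nonneg hw1]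
    rw [norm_polar htpos.le] at h1
    nlinarith [le_max_left s r, le_max_right s r]
  · have e1 : eucSide s t a = (1 - w) * eucSide s r (a + b) := by
      have := norm_polar_sub s t a 0
      rw [sub_zero] at this
      rw [← this, key]
      have h2 := norm_polar_sub s r a (-b)
      rw [sub_neg_eq_add] at h2
      rw [← h2, show polar s a - ((w : ℂ) * polar s a + ((1 - w : ℝ) : ℂ) * polar r (-b))
        = ((1 - w : ℝ) : ℂ) * (polar s a - polar r (-b)) by push_cast; ring, norm_mul,
        Complex.norm_real, Real.norm_of_nonneg hw1]
    have e2 : eucSide t r b = w * eucSide s r (a + b) := by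
      have := norm_polar_sub t r 0 (-b)
      rw [zero_sub, neg_neg] at this
      rw [← this, key]
      have h2 := norm_polar_sub s r a (-b)
      rw [sub_neg_eq_add] at h2
      rw [← h2, show ((w : ℂ) * polar s a + ((1 - w : ℝ) : ℂ) * polar r (-b)) - polar r (-b)
        = (w : ℂ) * (polar s a - polar r (-b)) by push_cast; ring, norm_mul,
        Complex.norm_real, Real.norm_of_nonneg hw0]
    rw [e1, e2]; ring

/-- If `eucSide` with angles `α`, `β`, `γ` satisfies the triangle inequality for all positive
radii, then `γ ≤ α + β`. -/
lemma angle_tri_of_eucSide_tri {α β γ ε : ℝ} (hα : 0 ≤ α) (hβ : 0 ≤ β) (hγ : γ ≤ Real.pi)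
    (hε : 0 < ε) {s r : ℝ} (hs : 0 < s) (hr : 0 < r)
    (h : α + ε ≤ Real.pi → β + ε ≤ Real.pi → ∀ t, 0 < t → t ≤ max s r →
      eucSide s r γ ≤ eucSide s t (α + ε) + eucSide t r (β + ε)) :
    γ ≤ α + β + 2 * ε := by
  rcases lt_or_ge (α + β + 2 * ε) Real.pi with hlt | hge
  · obtain ⟨t, ht, htm, he⟩ := eucSide_split (a := α + ε) (b := β + ε) hs hr (by linarith)
      (by linarith) (by linarith)
    have h1 := h (by linarith) (by linarith) t ht htm
    rw [he] at h1
    have := angle_le_of_eucSide_le hs hr (by linarith) hγ h1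
    linarith
  · linarith

/-! ### Comparison angles, CAT(0) spaces, bounded curvature -/

section Metric

variable {X : Type*} [MetricSpace X]

/-- The comparison angle at `x` between `y` and `z`: the angle at the vertex corresponding to `x`
of a planar Euclidean triangle with side lengths `dist x y`, `dist x z`, `dist y z`
(meaningful for `y ≠ x ≠ z`). -/
def compAngle (x y z : X) : ℝ :=
  Real.arccos ((dist x y ^ 2 + dist x z ^ 2 - dist y z ^ 2) / (2 * dist x y * dist x z))

/-- Area of the planar comparison triangle of `x, y, z`. -/
def compArea (x y z : X) : ℝ :=
  dist x y * dist x z * Real.sin (compAngle x y z) / 2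

variable (X) in
/-- A CAT(0) space: a geodesic metric space all of whose geodesic triangles are at least as thin
as their planar comparison triangles. -/
structure IsCAT0 : Prop where
  /-- Any two points are joined by a geodesic segment. -/
  geodesic : ∀ x y : X, ∃ c : ℝ → X, c 0 = x ∧ c (dist x y) = y ∧
    ∀ s ∈ Set.Icc 0 (dist x y), ∀ t ∈ Set.Icc 0 (dist x y), dist (c s) (c t) = |s - t|
  /-- For `p` on a side `[x, y]` and `q` on a side `[x, z]`, the distance from `p` to `q` is at most
  the distance of the comparison points in a planar comparison triangle. -/
  comparison : ∀ (x y z p q : X) (x' y' z' p' q' : EuclideanSpace ℝ (Fin 2)),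
    dist x' y' = dist x y → dist x' z' = dist x z → dist y' z' = dist y z →
    dist x p + dist p y = dist x y → dist x q + dist q z = dist x z →
    dist x' p' = dist x p → dist p' y' = dist p y →
    dist x' q' = dist x q → dist q' z' = dist q z →
    dist p q ≤ dist p' q'

variable (X) in
/-- A CAT(0) symmetric space: a complete CAT(0) space such that for every point `x` there is an
involutive isometry whose unique fixed point is `x`. -/
structure IsCAT0Symmetric : Prop where
  cat0 : IsCAT0 X
  complete : CompleteSpace X
  symmetry : ∀ x : X, ∃ σ : X ≃ᵢ X, (∀ y, σ (σ y) = y) ∧ ∀ y, σ y = y ↔ y = x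

variable (X) in
/-- Bounded curvature of a CAT(0) space. The conditions on `y'` and `z'` say that they lie on the
half-open geodesic segments `]x, y]` and `]x, z]`. -/
def HasBoundedCurvature : Prop :=
  ∀ p : X, ∃ ρ > 0, ∃ μ > 0, ∀ x ∈ Metric.ball p ρ, ∀ y ∈ Metric.ball p ρ, ∀ z ∈ Metric.ball p ρ,
    x ≠ y → y ≠ z → x ≠ z →
    ∀ y' z' : X, y' ≠ x → dist x y' + dist y' y = dist x y →
      z' ≠ x → dist x z' + dist z' z = dist x z →
      |compAngle x y z - compAngle x y' z'| ≤ μ * compArea x y z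

/-! ### Space of directions -/

/-- Geodesic rays starting at `x`, parametrized by arc length. -/
structure GeodesicRay (x : X) where
  toFun : ℝ≥0 → X
  isometry : Isometry toFun
  start : toFun 0 = x

/-- The (upper) Alexandrov angle between two geodesic rays starting at `x`. -/
def alexandrovAngle {x : X} (c c' : GeodesicRay x) : ℝ :=
  limsup (fun p : ℝ≥0 × ℝ≥0 => compAngle x (c.toFun p.1) (c'.toFun p.2))
    (𝓝[>] (0 : ℝ≥0) ×ˢ 𝓝[>] (0 : ℝ≥0))

lemma GeodesicRay.dist_start {x : X} (c : GeodesicRay x) (t : ℝ≥0) : dist x (c.toFun t) = t := by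
  have h := c.isometry.dist_eq 0 t
  rw [c.start, NNReal.dist_eq] at h
  simpa using h

lemma compAngle_nonneg (x y z : X) : 0 ≤ compAngle x y z := Real.arccos_nonneg _

lemma compAngle_le_pi (x y z : X) : compAngle x y z ≤ Real.pi := Real.arccos_le_pi _

lemma compAngle_comm (x y z : X) : compAngle x y z = compAngle x z y := by
  unfold compAngle; rw [dist_comm y z]; congr 1; ring

lemma dist_eq_eucSide {x y z : X} (hy : x ≠ y) (hz : x ≠ z) :
    dist y z = eucSide (dist x y) (dist x z) (compAngle x y z) := by
  have h1 : 0 < dist x y := dist_pos.2 hy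
  have h2 : 0 < dist x z := dist_pos.2 hz
  have t1 := dist_triangle_left y z x
  have t2 := dist_triangle x y z
  have t3 := dist_triangle_right x y z
  rw [eucSide, compAngle, Real.cos_arccos]
  · rw [eq_comm, show dist x y ^ 2 + dist x z ^ 2 - 2 * dist x y * dist x z *
      ((dist x y ^ 2 + dist x z ^ 2 - dist y z ^ 2) / (2 * dist x y * dist x z)) = dist y z ^ 2 by
      field_simp; ring]
    exact Real.sqrt_sq dist_nonneg
  · rw [le_div_iff₀ (by positivity)]
    nlinarith [dist_nonneg (x := y) (y := z)]
  · rw [div_le_one (by positivity)]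
    have : |dist x y - dist x z| ≤ dist y z := abs_sub_le_iff.2 ⟨by linarith, by linarith⟩
    nlinarith [sq_abs (dist x y - dist x z), abs_nonneg (dist x y - dist x z)]

lemma alexandrovAngle_bdd {x : X} (c c' : GeodesicRay x) :
    IsBoundedUnder (· ≤ ·) (𝓝[>] (0 : ℝ≥0) ×ˢ 𝓝[>] (0 : ℝ≥0))
      (fun p : ℝ≥0 × ℝ≥0 => compAngle x (c.toFun p.1) (c'.toFun p.2)) :=
  isBoundedUnder_of ⟨Real.pi, fun _ => compAngle_le_pi _ _ _⟩

lemma alexandrovAngle_cobdd {x : X} (c c' : GeodesicRay x) :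
    IsCoboundedUnder (· ≤ ·) (𝓝[>] (0 : ℝ≥0) ×ˢ 𝓝[>] (0 : ℝ≥0))
      (fun p : ℝ≥0 × ℝ≥0 => compAngle x (c.toFun p.1) (c'.toFun p.2)) :=
  (isBoundedUnder_of ⟨0, fun _ => compAngle_nonneg _ _ _⟩ :
    IsBoundedUnder (· ≥ ·) _ _).isCoboundedUnder_le

lemma alexandrovAngle_nonneg {x : X} (c c' : GeodesicRay x) : 0 ≤ alexandrovAngle c c' :=
  le_limsup_of_frequently_le (Frequently.of_forall fun _ => compAngle_nonneg _ _ _)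
    (alexandrovAngle_bdd c c')

lemma alexandrovAngle_comm {x : X} (c c' : GeodesicRay x) :
    alexandrovAngle c c' = alexandrovAngle c' c := by
  unfold alexandrovAngle
  conv_lhs => rw [prod_comm]
  rw [limsup, limsup, map_map]
  congr 2
  funext p
  exact compAngle_comm _ _ _

lemma alexandrovAngle_self {x : X} (c : GeodesicRay x) : alexandrovAngle c c = 0 := by
  have h : (fun p : ℝ≥0 × ℝ≥0 => compAngle x (c.toFun p.1) (c.toFun p.2)) =ᶠ[
      𝓝[>] (0 : ℝ≥0) ×ˢ 𝓝[>] (0 : ℝ≥0)] fun _ => (0 : ℝ) := by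
    have h1 : ∀ᶠ t : ℝ≥0 in 𝓝[>] (0 : ℝ≥0), 0 < t := eventually_mem_nhdsWithin
    filter_upwards [h1.prod_mk h1] with p hp
    obtain ⟨hp1, hp2⟩ := hp
    have hp1' : (0 : ℝ) < p.1 := hp1
    have hp2' : (0 : ℝ) < p.2 := hp2
    unfold compAngle
    rw [c.dist_start, c.dist_start, c.isometry.dist_eq, NNReal.dist_eq, sq_abs]
    rw [show ((p.1 : ℝ) ^ 2 + (p.2 : ℝ) ^ 2 - ((p.1 : ℝ) - p.2) ^ 2) / (2 * p.1 * p.2) = 1 by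
      field_simp; ring]
    exact Real.arccos_one
  rw [alexandrovAngle, limsup_congr h]
  exact limsup_const 0

lemma alexandrovAngle_triangle {x : X} (c₁ c₂ c₃ : GeodesicRay x) :
    alexandrovAngle c₁ c₃ ≤ alexandrovAngle c₁ c₂ + alexandrovAngle c₂ c₃ := by
  refine le_of_forall_pos_le_add fun δ hδ => ?_
  have hε : 0 < δ / 2 := by positivity
  have h12 := eventually_lt_of_limsup_lt
    (show alexandrovAngle c₁ c₂ < alexandrovAngle c₁ c₂ + δ / 2 by linarith)
    (alexandrovAngle_bdd c₁ c₂)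
  have h23 := eventually_lt_of_limsup_lt
    (show alexandrovAngle c₂ c₃ < alexandrovAngle c₂ c₃ + δ / 2 by linarith)
    (alexandrovAngle_bdd c₂ c₃)
  have hbasis : (𝓝[>] (0 : ℝ≥0)).HasBasis (fun e => 0 < e) (fun e => Set.Ioo 0 e) :=
    nhdsGT_basis 0
  obtain ⟨e₁, he₁, H₁⟩ := (hbasis.prod_self.eventually_iff).1 h12
  obtain ⟨e₂, he₂, H₂⟩ := (hbasis.prod_self.eventually_iff).1 h23
  refine limsup_le_of_le (alexandrovAngle_cobdd c₁ c₃) ?_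
  refine (hbasis.prod_self.eventually_iff).2 ⟨min e₁ e₂, lt_min he₁ he₂, ?_⟩
  rintro ⟨s, r⟩ ⟨⟨hs0, hs⟩, ⟨hr0, hr⟩⟩
  simp only at hs0 hs hr0 hr ⊢
  have hne : ∀ (c : GeodesicRay x) (u : ℝ≥0), 0 < u → x ≠ c.toFun u := by
    intro c u hu h
    have h1 := c.dist_start u
    rw [← h, dist_self] at h1
    exact hu.ne (by exact_mod_cast h1)
  have main := angle_tri_of_eucSide_tri (γ := compAngle x (c₁.toFun s) (c₃.toFun r))
    (alexandrovAngle_nonneg c₁ c₂) (alexandrovAngle_nonneg c₂ c₃)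
    (compAngle_le_pi _ _ _) hε (s := s) (r := r) (by exact_mod_cast hs0) (by exact_mod_cast hr0)
  have hfin := main ?_
  · linarith
  intro hp1 hp2 t ht htm
  lift t to ℝ≥0 using ht.le
  have ht0 : 0 < t := by exact_mod_cast ht
  have htm' : t ≤ max s r := by exact_mod_cast htm
  have htlt : t < min e₁ e₂ := htm'.trans_lt (max_lt hs hr)
  have hA : ∀ (c c' : GeodesicRay x) (u v : ℝ≥0) (A : ℝ), 0 < u → 0 < v →
      compAngle x (c.toFun u) (c'.toFun v) < A → A ≤ Real.pi →
      dist (c.toFun u) (c'.toFun v) ≤ eucSide u v A := by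
    intro c c' u v A hu hv hA hp
    rw [dist_eq_eucSide (hne c u hu) (hne c' v hv), c.dist_start, c'.dist_start]
    exact eucSide_mono u.2 v.2 (compAngle_nonneg _ _ _) hA.le hp
  have k1 := H₁ (x := (s, t)) ⟨⟨hs0, hs.trans_le (min_le_left _ _)⟩,
    ⟨ht0, htlt.trans_le (min_le_left _ _)⟩⟩
  have k2 := H₂ (x := (t, r)) ⟨⟨ht0, htlt.trans_le (min_le_right _ _)⟩,
    ⟨hr0, hr.trans_le (min_le_right _ _)⟩⟩
  have d := dist_triangle (c₁.toFun s) (c₂.toFun t) (c₃.toFun r)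
  rw [dist_eq_eucSide (hne c₁ s hs0) (hne c₃ r hr0), c₁.dist_start, c₃.dist_start] at d
  have a1 := hA c₁ c₂ s t _ hs0 ht0 k1 hp1
  have a2 := hA c₂ c₃ t r _ ht0 hr0 k2 hp2
  linarith

instance (x : X) : PseudoMetricSpace (GeodesicRay x) where
  dist c c' := alexandrovAngle c c'
  dist_self := alexandrovAngle_self
  dist_comm := alexandrovAngle_comm
  dist_triangle := alexandrovAngle_triangle

/-- The space of directions at `x`: geodesic rays starting at `x`, two rays being identified when
their Alexandrov angle vanishes, with the Alexandrov angle as metric. -/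
def SpaceOfDirections (x : X) : Type _ := SeparationQuotient (GeodesicRay x)

instance (x : X) : MetricSpace (SpaceOfDirections x) :=
  inferInstanceAs (MetricSpace (SeparationQuotient (GeodesicRay x)))

end Metric

/-! ### Euclidean cones and the tangent cone -/

/-- The Euclidean cone over `Y`, i.e. `[0, ∞) × Y` with `{0} × Y` collapsed to one point: it
consists of the apex and of the pairs `(r, y)` with `r > 0` and `y ∈ Y`. -/
inductive EuclideanCone (Y : Type*) where
  | apex : EuclideanCone Y
  | ray (r : ℝ) (hr : 0 < r) (y : Y) : EuclideanCone Y

namespace EuclideanCone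

variable {Y : Type*} [MetricSpace Y]

/-- The cone distance: `d((r,y),(s,z))² = r² + s² - 2 r s cos (min (d(y,z)) π)`. -/
def coneDist : EuclideanCone Y → EuclideanCone Y → ℝ
  | apex, apex => 0
  | apex, ray s _ _ => s
  | ray r _ _, apex => r
  | ray r _ y, ray s _ z => eucSide r s (min (dist y z) Real.pi)

lemma min_pi_nonneg (y z : Y) : 0 ≤ min (dist y z) Real.pi :=
  le_min dist_nonneg Real.pi_pos.le

lemma min_pi_triangle (y z w : Y) :
    min (dist y w) Real.pi ≤ min (dist y z) Real.pi + min (dist z w) Real.pi := by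
  have h := dist_triangle y z w
  have h1 := dist_nonneg (x := y) (y := z)
  have h2 := dist_nonneg (x := z) (y := w)
  have h3 := Real.pi_pos
  rcases min_cases (dist y w) Real.pi with a | a <;>
  rcases min_cases (dist y z) Real.pi with b | b <;>
  rcases min_cases (dist z w) Real.pi with c | c <;> linarith

lemma cone_tri {s t r : ℝ} (hs : 0 ≤ s) (ht : 0 ≤ t) (hr : 0 ≤ r) (y z w : Y) :
    eucSide s r (min (dist y w) Real.pi) ≤
      eucSide s t (min (dist y z) Real.pi) + eucSide t r (min (dist z w) Real.pi) :=
  eucSide_cone_tri hs ht hr (min_le_right _ _) (min_le_right _ _) (min_pi_nonneg _ _)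
    (min_le_right _ _) (min_pi_triangle y z w)

instance : MetricSpace (EuclideanCone Y) where
  dist := coneDist
  dist_self p := by
    cases p with
    | apex => rfl
    | ray r hr y =>
      change eucSide r r (min (dist y y) Real.pi) = 0
      rw [dist_self, min_eq_left Real.pi_pos.le, eucSide_self_zero]
  dist_comm p q := by
    cases p <;> cases q <;> simp only [coneDist]
    rw [eucSide_comm, dist_comm]
  dist_triangle p q u := by
    cases p with
    | apex =>
      cases q with
      | apex => cases u <;> simp [coneDist]
      | ray s hs z =>
        cases u with
        | apex => simp only [coneDist]; linarith
        | ray r hr w =>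
          simp only [coneDist]
          have := cone_tri le_rfl hs.le hr.le z z w
          rwa [eucSide_comm 0, eucSide_comm 0, eucSide_zero_right hr.le,
            eucSide_zero_right hs.le] at this
    | ray t ht y =>
      cases q with
      | apex =>
        cases u with
        | apex => simp [coneDist]
        | ray r hr w =>
          simp only [coneDist]
          have := cone_tri ht.le le_rfl hr.le y y w
          rwa [eucSide_comm 0, eucSide_zero_right hr.le, eucSide_zero_right ht.le] at this
      | ray s hs z =>
        cases u with
        | apex =>
          simp only [coneDist]
          have := cone_tri ht.le hs.le le_rfl y z z
          rwa [eucSide_zero_right ht.le, eucSide_zero_right hs.le] at this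
        | ray r hr w =>
          simp only [coneDist]
          exact cone_tri ht.le hs.le hr.le y z w
  eq_of_dist_eq_zero {p q} h := by
    cases p with
    | apex =>
      cases q with
      | apex => rfl
      | ray s hs z => exact absurd h hs.ne'
    | ray r hr y =>
      cases q with
      | apex => exact absurd h hr.ne'
      | ray s hs z =>
        change eucSide r s (min (dist y z) Real.pi) = 0 at h
        have h2 := eucSide_sq r s (min (dist y z) Real.pi)
        rw [h] at h2
        have hc := Real.cos_le_one (min (dist y z) Real.pi)
        have hrs : r = s := by nlinarith [mul_pos hr hs, sq_nonneg (r - s)]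
        subst hrs
        have hle : min (dist y z) Real.pi ≤ 0 :=
          angle_le_of_eucSide_le hr hr le_rfl (min_le_right _ _)
            (by rw [h, eucSide_self_zero])
        have h0 : dist y z = 0 := by
          rcases min_le_iff.1 hle with h | h
          · exact le_antisymm h dist_nonneg
          · exact absurd h (not_le.2 Real.pi_pos)
        rw [dist_eq_zero.1 h0]

end EuclideanCone

/-- The tangent cone at `x`: the Euclidean cone over the space of directions at `x`. -/
abbrev TangentCone {X : Type*} [MetricSpace X] (x : X) : Type _ :=
  EuclideanCone (SpaceOfDirections x)

/-! ### Pythagorean integrals -/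

section Integral

variable {Ω : Type*} [MeasurableSpace Ω]

/-- Minkowski's inequality in `L²`. -/
lemma sqrt_integral_sq_le {μ : Measure Ω} {F G H : Ω → ℝ}
    (hF : AEStronglyMeasurable F μ) (hG : AEStronglyMeasurable G μ)
    (hF0 : ∀ t, 0 ≤ F t) (hG0 : ∀ t, 0 ≤ G t) (hH0 : ∀ t, 0 ≤ H t) (h : ∀ t, H t ≤ F t + G t)
    (hF2 : Integrable (fun t => F t ^ 2) μ) (hG2 : Integrable (fun t => G t ^ 2) μ) :
    √(∫ t, H t ^ 2 ∂μ) ≤ √(∫ t, F t ^ 2 ∂μ) + √(∫ t, G t ^ 2 ∂μ) := by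
  have mF : MemLp F 2 μ := (memLp_two_iff_integrable_sq hF).2 hF2
  have mG : MemLp G 2 μ := (memLp_two_iff_integrable_sq hG).2 hG2
  have hFG : Integrable (fun t => F t * G t) μ := mF.integrable_mul mG
  have hS : Integrable (fun t => (F t + G t) ^ 2) μ := (mF.add mG).integrable_sq
  have hold : ∫ t, F t * G t ∂μ ≤ √(∫ t, F t ^ 2 ∂μ) * √(∫ t, G t ^ 2 ∂μ) := by
    have := integral_mul_le_Lp_mul_Lq_of_nonneg (μ := μ) Real.HolderConjugate.two_two
      (f := F) (g := G) (Eventually.of_forall hF0) (Eventually.of_forall hG0)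
      (by simpa using mF) (by simpa using mG)
    simpa [Real.sqrt_eq_rpow] using this
  have h1 : ∫ t, H t ^ 2 ∂μ ≤ ∫ t, (F t + G t) ^ 2 ∂μ :=
    integral_mono_of_nonneg (Eventually.of_forall fun t => sq_nonneg _) hS
      (Eventually.of_forall fun t => pow_le_pow_left₀ (hH0 t) (h t) 2)
  have h2 : ∫ t, (F t + G t) ^ 2 ∂μ =
      ∫ t, F t ^ 2 ∂μ + 2 * ∫ t, F t * G t ∂μ + ∫ t, G t ^ 2 ∂μ := by
    have e : ∀ t, (F t + G t) ^ 2 = (F t ^ 2 + 2 * (F t * G t)) + G t ^ 2 := fun t => by ring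
    have i : Integrable (fun t => F t ^ 2 + 2 * (F t * G t)) μ := hF2.add (hFG.const_mul 2)
    simp_rw [e]
    rw [integral_add i hG2, integral_add hF2 (hFG.const_mul 2),
      integral_const_mul]
  apply Real.sqrt_le_iff.2
  refine ⟨by positivity, ?_⟩
  have e1 : √(∫ t, F t ^ 2 ∂μ) ^ 2 = ∫ t, F t ^ 2 ∂μ :=
    Real.sq_sqrt (integral_nonneg fun t => sq_nonneg (F t))
  have e2 : √(∫ t, G t ^ 2 ∂μ) ^ 2 = ∫ t, G t ^ 2 ∂μ :=
    Real.sq_sqrt (integral_nonneg fun t => sq_nonneg (G t))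
  nlinarith

variable {Y : Type*} [MetricSpace Y]

/-- The Pythagorean integral `L²(Ω, Y)` with base point `o`: almost everywhere classes of (strongly)
measurable maps `f : Ω → Y` such that `t ↦ d(o, f t)` is square integrable. -/
def PythagoreanIntegral (μ : Measure Ω) (o : Y) : Type _ :=
  {f : Ω →ₘ[μ] Y // Integrable (fun t => dist o (f t) ^ 2) μ}

lemma PythagoreanIntegral.integrable_dist_sq {μ : Measure Ω} {o : Y}
    (f g : PythagoreanIntegral μ o) : Integrable (fun t => dist (f.1 t) (g.1 t) ^ 2) μ := by
  refine ((f.2.const_mul 2).add (g.2.const_mul 2)).mono'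
    ((f.1.aestronglyMeasurable.dist g.1.aestronglyMeasurable).pow 2)
    (Eventually.of_forall fun t => ?_)
  have h := dist_triangle_left (f.1 t) (g.1 t) o
  have h0 := dist_nonneg (x := f.1 t) (y := g.1 t)
  simp only [Pi.add_apply, Real.norm_eq_abs, abs_pow, abs_of_nonneg h0]
  nlinarith [sq_nonneg (dist o (f.1 t) - dist o (g.1 t))]

/-- The distance of the Pythagorean integral is `d(f, g) = (∫ d(f t, g t)²)^(1/2)`. -/
instance (μ : Measure Ω) (o : Y) : MetricSpace (PythagoreanIntegral μ o) where
  dist f g := √(∫ t, dist (f.1 t) (g.1 t) ^ 2 ∂μ)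
  dist_self f := by simp
  dist_comm f g := by simp only [dist_comm]
  dist_triangle f g h :=
    sqrt_integral_sq_le (f.1.aestronglyMeasurable.dist g.1.aestronglyMeasurable)
      (g.1.aestronglyMeasurable.dist h.1.aestronglyMeasurable)
      (fun _ => dist_nonneg) (fun _ => dist_nonneg) (fun _ => dist_nonneg)
      (fun _ => dist_triangle _ _ _) (f.integrable_dist_sq g) (g.integrable_dist_sq h)
  eq_of_dist_eq_zero {f g} h := by
    have h0 : 0 ≤ ∫ t, dist (f.1 t) (g.1 t) ^ 2 ∂μ := integral_nonneg fun _ => sq_nonneg _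
    have h1 := (Real.sqrt_eq_zero h0).1 h
    rw [integral_eq_zero_iff_of_nonneg (fun _ => sq_nonneg _) (f.integrable_dist_sq g)] at h1
    apply Subtype.ext
    apply AEEqFun.ext
    filter_upwards [h1] with t ht
    exact dist_eq_zero.1 (pow_eq_zero_iff (two_ne_zero)|>.1 ht)

/-! ### Integral joins -/

/-- The pairs `(y, v)` of measurable maps `y : Ω → Y`, `v : Ω → [0, ∞)` with `∫ v² = 1`
(for separable `Y`, strong measurability of `y` is measurability). -/
structure JoinPair (μ : Measure Ω) (Y : Type*) [MetricSpace Y] where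
  point : Ω → Y
  weight : Ω → ℝ
  point_meas : StronglyMeasurable point
  weight_meas : Measurable weight
  weight_nonneg : ∀ τ, 0 ≤ weight τ
  weight_integral : ∫ τ, weight τ ^ 2 ∂μ = 1

namespace JoinPair

variable {μ : Measure Ω}

/-- `∫ v w cos d(x, y)`; the minimum with `π` has no effect for spaces `Y` of diameter at most `π`,
such as spaces of directions. -/
def pairing (p q : JoinPair μ Y) : ℝ :=
  ∫ τ, p.weight τ * q.weight τ * Real.cos (min (dist (p.point τ) (q.point τ)) Real.pi) ∂μ

lemma weight_sq_integrable (p : JoinPair μ Y) : Integrable (fun τ => p.weight τ ^ 2) μ := by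
  by_contra h
  have := p.weight_integral
  rw [integral_undef h] at this
  exact zero_ne_one this

lemma angle_meas (p q : JoinPair μ Y) :
    Measurable fun τ => min (dist (p.point τ) (q.point τ)) Real.pi :=
  ((p.point_meas.dist q.point_meas).measurable).min measurable_const

lemma pairing_integrable (p q : JoinPair μ Y) : Integrable (fun τ =>
    p.weight τ * q.weight τ * Real.cos (min (dist (p.point τ) (q.point τ)) Real.pi)) μ := by
  refine (p.weight_sq_integrable.add q.weight_sq_integrable).mono'
    ((p.weight_meas.mul q.weight_meas).mul
      (Real.measurable_cos.comp (angle_meas p q))).aestronglyMeasurable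
    (Eventually.of_forall fun τ => ?_)
  have h1 := p.weight_nonneg τ
  have h2 := q.weight_nonneg τ
  have h3 := Real.abs_cos_le_one (min (dist (p.point τ) (q.point τ)) Real.pi)
  simp only [Pi.add_apply, Real.norm_eq_abs, abs_mul, abs_of_nonneg h1, abs_of_nonneg h2]
  nlinarith [mul_nonneg h1 h2, sq_nonneg (p.weight τ - q.weight τ),
    mul_le_mul_of_nonneg_left h3 (mul_nonneg h1 h2)]

lemma eucSide_sq_integrable (p q : JoinPair μ Y) (s t : ℝ) :
    Integrable (fun τ => eucSide (s * p.weight τ) (t * q.weight τ)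
      (min (dist (p.point τ) (q.point τ)) Real.pi) ^ 2) μ := by
  have h := ((p.weight_sq_integrable.const_mul (s ^ 2)).add
    (q.weight_sq_integrable.const_mul (t ^ 2))).sub ((pairing_integrable p q).const_mul (2 * s * t))
  refine h.congr (Eventually.of_forall fun τ => ?_)
  simp only [Pi.sub_apply, Pi.add_apply]
  rw [eucSide_sq]; ring

lemma integral_eucSide_sq (p q : JoinPair μ Y) (s t : ℝ) :
    ∫ τ, eucSide (s * p.weight τ) (t * q.weight τ)
      (min (dist (p.point τ) (q.point τ)) Real.pi) ^ 2 ∂μ =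
      s ^ 2 + t ^ 2 - 2 * s * t * pairing p q := by
  have e : ∀ τ, eucSide (s * p.weight τ) (t * q.weight τ)
      (min (dist (p.point τ) (q.point τ)) Real.pi) ^ 2 =
      s ^ 2 * p.weight τ ^ 2 + t ^ 2 * q.weight τ ^ 2 - 2 * s * t *
      (p.weight τ * q.weight τ * Real.cos (min (dist (p.point τ) (q.point τ)) Real.pi)) := by
    intro τ; rw [eucSide_sq]; ring
  have i : Integrable (fun τ => s ^ 2 * p.weight τ ^ 2 + t ^ 2 * q.weight τ ^ 2) μ :=
    (p.weight_sq_integrable.const_mul (s ^ 2)).add (q.weight_sq_integrable.const_mul (t ^ 2))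
  simp_rw [e]
  rw [integral_sub i ((pairing_integrable p q).const_mul (2 * s * t)),
    integral_add (p.weight_sq_integrable.const_mul (s ^ 2))
    (q.weight_sq_integrable.const_mul (t ^ 2)), integral_const_mul, integral_const_mul,
    integral_const_mul, p.weight_integral, q.weight_integral, pairing]
  ring

lemma pairing_le_one (p q : JoinPair μ Y) : pairing p q ≤ 1 := by
  have h := integral_eucSide_sq p q 1 1
  have h0 : 0 ≤ ∫ τ, eucSide (1 * p.weight τ) (1 * q.weight τ)
      (min (dist (p.point τ) (q.point τ)) Real.pi) ^ 2 ∂μ := integral_nonneg fun _ => sq_nonneg _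
  linarith

lemma neg_one_le_pairing (p q : JoinPair μ Y) : -1 ≤ pairing p q := by
  have h := integral_eucSide_sq p q 1 (-1)
  have h0 : 0 ≤ ∫ τ, eucSide (1 * p.weight τ) (-1 * q.weight τ)
      (min (dist (p.point τ) (q.point τ)) Real.pi) ^ 2 ∂μ := integral_nonneg fun _ => sq_nonneg _
  linarith

lemma eucSide_arccos_pairing (p q : JoinPair μ Y) (s t : ℝ) :
    eucSide s t (Real.arccos (pairing p q)) =
      √(∫ τ, eucSide (s * p.weight τ) (t * q.weight τ)
        (min (dist (p.point τ) (q.point τ)) Real.pi) ^ 2 ∂μ) := by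
  rw [integral_eucSide_sq, eucSide, Real.cos_arccos (neg_one_le_pairing p q) (pairing_le_one p q)]

lemma eucSide_aesm (p q : JoinPair μ Y) (s t : ℝ) :
    AEStronglyMeasurable (fun τ => eucSide (s * p.weight τ) (t * q.weight τ)
      (min (dist (p.point τ) (q.point τ)) Real.pi)) μ := by
  have h1 := p.weight_meas
  have h2 := q.weight_meas
  have h3 := Real.measurable_cos.comp (angle_meas p q)
  have : Measurable (fun τ => eucSide (s * p.weight τ) (t * q.weight τ)
      (min (dist (p.point τ) (q.point τ)) Real.pi)) := by
    unfold eucSide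
    refine Measurable.sqrt ?_
    exact ((((h1.const_mul s).pow_const 2).add ((h2.const_mul t).pow_const 2)).sub
      ((((h1.const_mul s).const_mul 2).mul (h2.const_mul t)).mul h3))
  exact this.aestronglyMeasurable

/-- The distance of the integral join is the number `d ∈ [0, π]` with
`cos d((x, v), (y, w)) = ∫ v w cos d(x, y)`. -/
instance : PseudoMetricSpace (JoinPair μ Y) where
  dist p q := Real.arccos (pairing p q)
  dist_self p := by
    have : pairing p p = 1 := by
      have h := p.weight_integral
      rw [← h, pairing]
      congr 1; funext τ
      rw [dist_self, min_eq_left Real.pi_pos.le, Real.cos_zero]; ring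
    rw [this, Real.arccos_one]
  dist_comm p q := by
    have : pairing p q = pairing q p := by
      unfold pairing; congr 1; funext τ; rw [dist_comm]; ring
    rw [this]
  dist_triangle p q u := by
    refine le_of_forall_pos_le_add fun δ hδ => ?_
    have := angle_tri_of_eucSide_tri (α := Real.arccos (pairing p q))
      (β := Real.arccos (pairing q u)) (γ := Real.arccos (pairing p u)) (ε := δ / 2)
      (Real.arccos_nonneg _) (Real.arccos_nonneg _) (Real.arccos_le_pi _) (by positivity)
      (s := 1) (r := 1) one_pos one_pos ?_
    · linarith
    intro ha hb t ht _
    refine le_trans ?_ (add_le_add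
      (eucSide_mono zero_le_one ht.le (Real.arccos_nonneg (pairing p q)) (by linarith) ha)
      (eucSide_mono ht.le zero_le_one (Real.arccos_nonneg (pairing q u)) (by linarith) hb))
    rw [eucSide_arccos_pairing, eucSide_arccos_pairing, eucSide_arccos_pairing]
    refine sqrt_integral_sq_le (eucSide_aesm p q 1 t) (eucSide_aesm q u t 1)
      (fun _ => eucSide_nonneg _ _ _) (fun _ => eucSide_nonneg _ _ _)
      (fun _ => eucSide_nonneg _ _ _) (fun τ => ?_)
      (eucSide_sq_integrable p q 1 t) (eucSide_sq_integrable q u t 1)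
    exact EuclideanCone.cone_tri (mul_nonneg zero_le_one (p.weight_nonneg τ))
      (mul_nonneg ht.le (q.weight_nonneg τ)) (mul_nonneg zero_le_one (u.weight_nonneg τ)) _ _ _

end JoinPair

/-- The integral join `∫*_Ω Y`: pairs `(y, v)`, identified when their distance vanishes. -/
def IntegralJoin (μ : Measure Ω) (Y : Type*) [MetricSpace Y] : Type _ :=
  SeparationQuotient (JoinPair μ Y)

instance (μ : Measure Ω) (Y : Type*) [MetricSpace Y] : MetricSpace (IntegralJoin μ Y) :=
  inferInstanceAs (MetricSpace (SeparationQuotient (JoinPair μ Y)))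

end Integral

/-- `L²([0,1], ℍ)`, where `ℍ` is the hyperbolic plane of curvature `-1` (the upper half-plane with
the metric `2 arsinh (|z - w| / (2 √(Im z Im w)))`) with base point `o`. -/
abbrev L2H (o : UpperHalfPlane) : Type :=
  PythagoreanIntegral (volume : Measure unitInterval) o

end PythInt

end

/-!
The proof rests on one notion, that of a *polar chart* at a point `x` of a metric space `Y`
(`PythInt.IsPolarChart`): a map `e` of an inner product space `V` onto `Y` with the metric
properties of the exponential map at `x` of a Hadamard manifold. If there are polar charts at all
points, then `Y` is CAT(0) (`isCAT0_of_polarChart`). The geodesic rays from `x` are the images of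
the linear rays (`IsPolarChart.exists_eq_ray`), and their Alexandrov angles are the angles of `V`
(`IsPolarChart.alexandrovAngle_ray`), because comparison angles are monotone in CAT(0) spaces and
`e` is infinitesimally isometric at `0`. Hence the space of directions at `x` is the unit sphere of
`V` and the tangent cone is `V` (`IsPolarChart.tangentConeEquiv`).

The exponential map `hexp p` of the hyperbolic plane at `p`, written explicitly, is a polar chart
(`isPolarChart_hexp`). Everything follows from the law of cosines and from the estimate
`‖v - w‖² ≤ d(exp v, exp w)² ≤ cosh ‖v‖ cosh ‖w‖ ‖v - w‖²`, whose first half expresses the convexity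
of `u ↦ cosh √u`. Since `hexp p v` and its inverse `hlog p z` are measurable in both variables, the
pointwise exponential map `l2exp x` is defined on `L²([0,1], ℝ²)`, and integration shows that it is
a polar chart of `L²([0,1], ℍ)` at `x` (`isPolarChart_l2exp`). This gives the CAT(0) property, the
geodesic symmetries `v ↦ -v`, and the spaces of directions and tangent cones: a unit vector of
`L²([0,1], ℝ²)` is a pair of a field of directions and a weight function, that is, a point of the
integral join.

The negative results use that the maps which are constant on a set of measure `k²` and equal to the
base point elsewhere form a copy of the hyperbolic plane scaled by the factor `k`
(`exists_scaled_copy`). So every ball contains copies of a fixed hyperbolic triangle, of area of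
order `k²` and with a change of comparison angles independent of `k`; this excludes bounded
curvature. On the other hand, a Riemannian manifold is near each point bi-Lipschitz to a Hilbert
space, with constants arbitrarily close to `1`, because the metric tensor is continuous
(`exists_nhds_enorm_tangentChart_sub_le`, `exists_nhds_edist_le_enorm_tangentChart`). A fixed
configuration of four points of the hyperbolic plane, consisting of the midpoint of a segment of
length `2`, its endpoints, and a point at distance `1` from the midpoint on the perpendicular, would
therefore embed isometrically, up to a factor close to `1` and a scaling, into a Hilbert space,
which `four_point_inequality` forbids.
-/

noncomputable section

namespace PythInt

/-! ### Metric spaces with polar charts -/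

section PolarChart

variable {V : Type*} [NormedAddCommGroup V] [InnerProductSpace ℝ V] {Y : Type*} [MetricSpace Y]

/-- A polar chart at `x`: a map `e` from an inner product space onto `Y` with the metric properties
of the exponential map at `x` of a complete simply connected space of nonpositive curvature. It
preserves distances to the centre, does not decrease distances, satisfies the CAT(0) inequality of
Bruhat and Tits along radial segments, and is infinitesimally isometric at the origin. -/
structure IsPolarChart (x : Y) (e : V → Y) : Prop where
  surjective : Function.Surjective e
  dist_center : ∀ v, dist x (e v) = ‖v‖
  norm_sub_le : ∀ v w, ‖v - w‖ ≤ dist (e v) (e w)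
  convexity : ∀ (v : V) (z : Y) (l : ℝ), 0 ≤ l → l ≤ 1 →
    dist (e (l • v)) z ^ 2 ≤
      (1 - l) * dist x z ^ 2 + l * dist (e v) z ^ 2 - l * (1 - l) * ‖v‖ ^ 2
  tendsto : ∀ v w, Tendsto (fun s : ℝ => dist (e (s • v)) (e (s • w)) ^ 2 / s ^ 2) (𝓝[>] 0)
    (𝓝 (‖v - w‖ ^ 2))

namespace IsPolarChart

variable {x : Y} {e : V → Y}

lemma map_zero (h : IsPolarChart x e) : e 0 = x := by
  have := h.dist_center 0
  rw [norm_zero, dist_eq_zero] at this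
  exact this.symm

lemma injective (h : IsPolarChart x e) : Function.Injective e := by
  intro v w hvw
  have := h.norm_sub_le v w
  rw [hvw, dist_self] at this
  exact sub_eq_zero.1 (norm_le_zero_iff.1 this)

lemma dist_smul_smul_le (h : IsPolarChart x e) (v : V) {l m : ℝ} (hl : 0 ≤ l) (hl1 : l ≤ 1)
    (hm : 0 ≤ m) (hm1 : m ≤ 1) : dist (e (l • v)) (e (m • v)) ≤ |l - m| * ‖v‖ := by
  have h1 := h.convexity v x m hm hm1
  have h2 := h.convexity v (e v) m hm hm1
  have h3 := h.convexity v (e (m • v)) l hl hl1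
  rw [dist_comm _ x, h.dist_center, dist_self, dist_comm, h.dist_center] at h1
  rw [dist_self, h.dist_center] at h2
  rw [h.dist_center, norm_smul, Real.norm_of_nonneg hm, dist_comm (e v)] at h3
  refine abs_le_of_sq_le_sq' ?_ (by positivity) |>.2
  rw [mul_pow, sq_abs]
  nlinarith

lemma dist_smul_smul (h : IsPolarChart x e) (v : V) {s t : ℝ} (hs : 0 ≤ s) (ht : 0 ≤ t) :
    dist (e (s • v)) (e (t • v)) = |s - t| * ‖v‖ := by
  apply le_antisymm
  · set r := s + t + 1
    have hr : 0 < r := by positivity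
    have := h.dist_smul_smul_le (r • v) (l := s / r) (m := t / r) (by positivity)
      (by rw [div_le_one hr]; linarith) (by positivity) (by rw [div_le_one hr]; linarith)
    rw [smul_smul, smul_smul, div_mul_cancel₀ _ hr.ne', div_mul_cancel₀ _ hr.ne', ← sub_div,
      abs_div, abs_of_pos hr, norm_smul, Real.norm_of_nonneg hr.le, ← mul_assoc,
      div_mul_cancel₀ _ hr.ne'] at this
    exact this
  · have := h.norm_sub_le (s • v) (t • v)
    rwa [← sub_smul, norm_smul, Real.norm_eq_abs] at this

/-- Uniqueness of geodesics issuing from the centre. -/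
lemma eq_smul_of_dist (h : IsPolarChart x e) (v : V) {p : Y} {l : ℝ} (hl : 0 ≤ l) (hl1 : l ≤ 1)
    (h1 : dist x p = l * ‖v‖) (h2 : dist (e v) p = (1 - l) * ‖v‖) : p = e (l • v) := by
  have := h.convexity v p l hl hl1
  rw [h1, h2] at this
  have h0 : dist (e (l • v)) p ^ 2 ≤ 0 := by nlinarith
  have : dist (e (l • v)) p = 0 := by
    have := sq_nonneg (dist (e (l • v)) p)
    exact pow_eq_zero_iff two_ne_zero |>.1 (le_antisymm h0 this)
  exact (dist_eq_zero.1 this).symm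

lemma exists_smul_of_between (h : IsPolarChart x e) (v : V) {p : Y}
    (hp : dist x p + dist p (e v) = ‖v‖) :
    ∃ l : ℝ, 0 ≤ l ∧ l ≤ 1 ∧ dist x p = l * ‖v‖ ∧ p = e (l • v) := by
  rcases eq_or_ne v 0 with rfl | hv
  · refine ⟨0, le_rfl, zero_le_one, ?_, ?_⟩
    · rw [norm_zero] at hp ⊢
      have := dist_nonneg (x := x) (y := p)
      have := dist_nonneg (x := p) (y := e 0)
      linarith
    · rw [norm_zero] at hp
      have := dist_nonneg (x := x) (y := p)
      have := dist_nonneg (x := p) (y := e 0)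
      rw [smul_zero]
      exact dist_eq_zero.1 (by linarith)
  · have hv' : 0 < ‖v‖ := norm_pos_iff.2 hv
    have d0 := dist_nonneg (x := x) (y := p)
    have d1 := dist_nonneg (x := p) (y := e v)
    have hl : 0 ≤ dist x p / ‖v‖ := by positivity
    have hl1 : dist x p / ‖v‖ ≤ 1 := by rw [div_le_one hv']; linarith
    have h1 : dist x p = dist x p / ‖v‖ * ‖v‖ := by field_simp
    refine ⟨dist x p / ‖v‖, hl, hl1, h1, h.eq_smul_of_dist v hl hl1 h1 ?_⟩
    rw [dist_comm, sub_mul, ← h1]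
    linarith

/-- The distance between points on two sides of a triangle is at most that of the corresponding
points of the comparison triangle. -/
lemma dist_sq_smul_smul_le (h : IsPolarChart x e) (v w : V) {l m : ℝ} (hl : 0 ≤ l) (hl1 : l ≤ 1)
    (hm : 0 ≤ m) (hm1 : m ≤ 1) : dist (e (l • v)) (e (m • w)) ^ 2 ≤
      l ^ 2 * ‖v‖ ^ 2 + m ^ 2 * ‖w‖ ^ 2 +
        l * m * (dist (e v) (e w) ^ 2 - ‖v‖ ^ 2 - ‖w‖ ^ 2) := by
  have h1 := h.convexity v (e (m • w)) l hl hl1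
  have h2 := h.convexity w (e v) m hm hm1
  rw [h.dist_center, norm_smul, Real.norm_of_nonneg hm] at h1
  rw [h.dist_center, dist_comm, dist_comm (e w)] at h2
  nlinarith [mul_le_mul_of_nonneg_left h2 hl]

end IsPolarChart

/-- In an inner product space, the estimate `IsPolarChart.dist_sq_smul_smul_le` is an equality. -/
lemma dist_sq_of_between {x y z p q : V} {l m : ℝ} (hl : 0 ≤ l) (hl1 : l ≤ 1) (hm : 0 ≤ m)
    (hm1 : m ≤ 1) (hp : dist x p = l * dist x y) (hp' : dist p y = (1 - l) * dist x y)
    (hq : dist x q = m * dist x z) (hq' : dist q z = (1 - m) * dist x z) :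
    dist p q ^ 2 = l ^ 2 * dist x y ^ 2 + m ^ 2 * dist x z ^ 2 +
      l * m * (dist y z ^ 2 - dist x y ^ 2 - dist x z ^ 2) := by
  have key : ∀ {a b : V} {k : ℝ}, dist x a = k * dist x b → dist a b = (1 - k) * dist x b →
      0 ≤ k → k ≤ 1 → a - x = k • (b - x) := by
    intro a b k h1 h2 h0 h3
    rw [← sub_eq_zero, ← norm_eq_zero, ← pow_eq_zero_iff two_ne_zero]
    have e1 : dist x a = ‖a - x‖ := by rw [dist_comm, dist_eq_norm]
    have e2 : dist x b = ‖b - x‖ := by rw [dist_comm, dist_eq_norm]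
    have e3 : dist a b = ‖(a - x) - (b - x)‖ := by rw [dist_eq_norm]; congr 1; abel
    rw [e1, e2] at h1
    rw [e3, e2] at h2
    have h4 := norm_sub_sq_real (a - x) (b - x)
    rw [h1, h2] at h4
    rw [norm_sub_sq_real, norm_smul, real_inner_smul_right, Real.norm_of_nonneg h0, h1]
    nlinarith
  have hp1 := key hp hp' hl hl1
  have hq1 := key hq hq' hm hm1
  have e1 : dist x y = ‖y - x‖ := by rw [dist_comm, dist_eq_norm]
  have e2 : dist x z = ‖z - x‖ := by rw [dist_comm, dist_eq_norm]
  have e3 : dist y z = ‖(y - x) - (z - x)‖ := by rw [dist_eq_norm]; congr 1; abel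
  have e4 : dist p q = ‖l • (y - x) - m • (z - x)‖ := by
    rw [dist_eq_norm, ← hp1, ← hq1]; congr 1; abel
  rw [e1, e2, e3, e4, norm_sub_sq_real (l • _), norm_sub_sq_real (y - x), norm_smul, norm_smul,
    real_inner_smul_right, real_inner_smul_left, Real.norm_of_nonneg hl, Real.norm_of_nonneg hm]
  ring

/-- A metric space with a polar chart at every point is CAT(0). -/
theorem isCAT0_of_polarChart (H : ∀ x : Y, ∃ e : V → Y, IsPolarChart x e) : IsCAT0 Y where
  geodesic x y := by
    obtain ⟨e, he⟩ := H x
    obtain ⟨v, rfl⟩ := he.surjective y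
    rw [he.dist_center]
    rcases eq_or_ne v 0 with rfl | hv
    · refine ⟨fun _ => x, rfl, by simp [he.map_zero], ?_⟩
      intro s hs t ht
      simp only [norm_zero, Set.Icc_self, Set.mem_singleton_iff] at hs ht
      simp [hs, ht]
    · have hv' : 0 < ‖v‖ := norm_pos_iff.2 hv
      refine ⟨fun s => e (s • ‖v‖⁻¹ • v), ?_, ?_, ?_⟩
      · simp [he.map_zero]
      · simp only
        rw [smul_smul, mul_inv_cancel₀ hv'.ne', one_smul]
      · intro s hs t ht
        rw [he.dist_smul_smul _ hs.1 ht.1, norm_smul, norm_inv, norm_norm,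
          inv_mul_cancel₀ hv'.ne', mul_one]
  comparison x y z p q x' y' z' p' q' hxy hxz hyz hp hq hxp hpy hxq hqz := by
    obtain ⟨e, he⟩ := H x
    obtain ⟨v, rfl⟩ := he.surjective y
    obtain ⟨w, rfl⟩ := he.surjective z
    rw [he.dist_center] at hp hq
    obtain ⟨l, hl, hl1, hlp, rfl⟩ := he.exists_smul_of_between v hp
    obtain ⟨m, hm, hm1, hmq, rfl⟩ := he.exists_smul_of_between w hq
    have h1 := he.dist_sq_smul_smul_le v w hl hl1 hm hm1
    have h2 := dist_sq_of_between (x := x') (y := y') (z := z') (p := p') (q := q') hl hl1 hm hm1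
      (by rw [hxp, hxy, hlp, he.dist_center])
      (by rw [hpy, hxy, he.dist_center]; linarith)
      (by rw [hxq, hxz, hmq, he.dist_center])
      (by rw [hqz, hxz, he.dist_center]; linarith)
    rw [hxy, hxz, hyz, he.dist_center, he.dist_center] at h2
    exact (abs_le_of_sq_le_sq' (h1.trans h2.ge) dist_nonneg).2

namespace IsPolarChart

variable {x : Y} {e : V → Y}

/-- The radial geodesic ray with initial direction `u`. -/
def ray (h : IsPolarChart x e) (u : V) (hu : ‖u‖ = 1) : GeodesicRay x where
  toFun t := e ((t : ℝ) • u)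
  isometry := by
    apply Isometry.of_dist_eq
    intro s t
    rw [h.dist_smul_smul u s.coe_nonneg t.coe_nonneg, hu, mul_one, NNReal.dist_eq]
  start := by simp [h.map_zero]

lemma exists_eq_ray (h : IsPolarChart x e) (c : GeodesicRay x) :
    ∃ (u : V) (hu : ‖u‖ = 1), c = h.ray u hu := by
  choose f hf using h.surjective
  have hn : ∀ t : ℝ≥0, ‖f (c.toFun t)‖ = t := fun t => by
    rw [← h.dist_center, hf, c.dist_start]
  have key : ∀ s t : ℝ≥0, s ≤ t → 0 < t →
      f (c.toFun s) = ((s : ℝ) / t) • f (c.toFun t) := by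
    intro s t hst ht
    have hst' : (s : ℝ) ≤ t := hst
    have ht' : (0 : ℝ) < t := ht
    apply h.injective
    rw [hf]
    refine h.eq_smul_of_dist _ (by positivity) (by rwa [div_le_one ht']) ?_ ?_
    · rw [c.dist_start, hn]; field_simp
    · rw [hf, c.isometry.dist_eq, NNReal.dist_eq, hn, abs_of_nonneg (by linarith)]; field_simp
  refine ⟨f (c.toFun 1), by simpa using hn 1, ?_⟩
  have hc : c.toFun = fun t : ℝ≥0 => e ((t : ℝ) • f (c.toFun 1)) := by
    funext t
    rw [← hf (c.toFun t)]
    congr 1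
    rcases le_total t 1 with ht | ht
    · rw [key t 1 ht one_pos]; simp
    · have ht0 : (0 : ℝ) < t := by
        have : (1 : ℝ) ≤ t := ht
        linarith
      rw [key 1 t ht (by exact_mod_cast ht0), smul_smul]
      simp [mul_inv_cancel₀ ht0.ne']
  cases c
  simpa [ray] using hc

/-- The Alexandrov angle between radial rays is the angle between their directions. -/
lemma alexandrovAngle_ray (h : IsPolarChart x e) {u v : V} (hu : ‖u‖ = 1) (hv : ‖v‖ = 1) :
    alexandrovAngle (h.ray u hu) (h.ray v hv) = InnerProductGeometry.angle u v := by
  have hcos : InnerProductGeometry.angle u v = Real.arccos (1 - ‖u - v‖ ^ 2 / 2) := by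
    rw [InnerProductGeometry.angle, norm_sub_sq_real, hu, hv]
    congr 1; ring
  have hpos : ∀ᶠ t : ℝ≥0 in 𝓝[>] (0 : ℝ≥0), 0 < t := eventually_mem_nhdsWithin
  have hdist : ∀ {w : V}, ‖w‖ = 1 → ∀ t : ℝ≥0, dist x (e ((t : ℝ) • w)) = t := by
    intro w hw t
    rw [h.dist_center, norm_smul, hw, mul_one, Real.norm_of_nonneg t.coe_nonneg]
  apply Tendsto.limsup_eq
  -- By monotonicity of comparison angles in CAT(0) spaces, the comparison angle at times `s`, `t`
  -- is at most the one at the equal times `max s t`.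
  have hupper : Tendsto (fun p : ℝ≥0 × ℝ≥0 => Real.arccos
      (1 - dist (e (((max p.1 p.2 : ℝ≥0) : ℝ) • u)) (e (((max p.1 p.2 : ℝ≥0) : ℝ) • v)) ^ 2
        / ((max p.1 p.2 : ℝ≥0) : ℝ) ^ 2 / 2))
      (𝓝[>] (0 : ℝ≥0) ×ˢ 𝓝[>] (0 : ℝ≥0)) (𝓝 (InnerProductGeometry.angle u v)) := by
    have hmax : Tendsto (fun p : ℝ≥0 × ℝ≥0 => ((max p.1 p.2 : ℝ≥0) : ℝ))
        (𝓝[>] (0 : ℝ≥0) ×ˢ 𝓝[>] (0 : ℝ≥0)) (𝓝[>] 0) := by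
      apply tendsto_nhdsWithin_of_tendsto_nhds_of_eventually_within
      · have : Tendsto (fun p : ℝ≥0 × ℝ≥0 => ((max p.1 p.2 : ℝ≥0) : ℝ)) (𝓝 (0, 0)) (𝓝 0) := by
          have : Continuous (fun p : ℝ≥0 × ℝ≥0 => ((max p.1 p.2 : ℝ≥0) : ℝ)) := by fun_prop
          simpa using this.tendsto (0, 0)
        refine this.mono_left ?_
        rw [nhds_prod_eq]
        exact Filter.prod_mono nhdsWithin_le_nhds nhdsWithin_le_nhds
      · filter_upwards [hpos.prod_mk hpos] with p hp
        have : 0 < max p.1 p.2 := lt_max_of_lt_left hp.1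
        exact_mod_cast this
    rw [hcos]
    refine (Real.continuous_arccos.tendsto _).comp ?_
    exact (tendsto_const_nhds.sub (((h.tendsto u v).div_const 2).comp hmax))
  refine tendsto_of_tendsto_of_tendsto_of_le_of_le' tendsto_const_nhds hupper ?_ ?_
  · filter_upwards [hpos.prod_mk hpos] with p hp
    have h1 : (0 : ℝ) < p.1 := hp.1
    have h2 : (0 : ℝ) < p.2 := hp.2
    rw [compAngle, hcos]
    apply Real.arccos_le_arccos
    simp only [ray]
    rw [hdist hu, hdist hv, div_le_iff₀ (by positivity)]
    have h3 := pow_le_pow_left₀ (norm_nonneg _) (h.norm_sub_le ((p.1 : ℝ) • u) ((p.2 : ℝ) • v)) 2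
    rw [norm_sub_sq_real, norm_smul, norm_smul, real_inner_smul_left, real_inner_smul_right, hu,
      hv, Real.norm_of_nonneg h1.le, Real.norm_of_nonneg h2.le] at h3
    rw [norm_sub_sq_real, hu, hv]
    nlinarith
  · filter_upwards [hpos.prod_mk hpos] with p hp
    have h1 : (0 : ℝ) < p.1 := hp.1
    have h2 : (0 : ℝ) < p.2 := hp.2
    rw [compAngle]
    apply Real.arccos_le_arccos
    simp only [ray]
    rw [hdist hu, hdist hv]
    set r : ℝ := ((max p.1 p.2 : ℝ≥0) : ℝ) with hr
    have hr1 : (p.1 : ℝ) ≤ r := by rw [hr]; exact_mod_cast le_max_left _ _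
    have hr2 : (p.2 : ℝ) ≤ r := by rw [hr]; exact_mod_cast le_max_right _ _
    have hr0 : 0 < r := h1.trans_le hr1
    have h3 := h.dist_sq_smul_smul_le (r • u) (r • v) (l := p.1 / r) (m := p.2 / r)
      (by positivity) (by rwa [div_le_one hr0]) (by positivity) (by rwa [div_le_one hr0])
    rw [smul_smul, smul_smul, div_mul_cancel₀ _ hr0.ne', div_mul_cancel₀ _ hr0.ne', norm_smul,
      norm_smul, hu, hv, Real.norm_of_nonneg hr0.le] at h3
    rw [le_div_iff₀ (by positivity)]
    set D := dist (e (r • u)) (e (r • v)) with hD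
    have h4 : (p.1 / r : ℝ) ^ 2 * (r * 1) ^ 2 + (p.2 / r : ℝ) ^ 2 * (r * 1) ^ 2 +
        p.1 / r * (p.2 / r) * (D ^ 2 - (r * 1) ^ 2 - (r * 1) ^ 2) =
        p.1 ^ 2 + p.2 ^ 2 - (1 - D ^ 2 / r ^ 2 / 2) * (2 * p.1 * p.2) := by
      field_simp; ring
    linarith

/-- The direction at `x` of a unit vector. -/
def direction (h : IsPolarChart x e) (u : Metric.sphere (0 : V) 1) : SpaceOfDirections x :=
  SeparationQuotient.mk (h.ray u (by simp))

lemma dist_direction (h : IsPolarChart x e) (u v : Metric.sphere (0 : V) 1) :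
    dist (h.direction u) (h.direction v) = InnerProductGeometry.angle (u : V) v :=
  h.alexandrovAngle_ray (by simp) (by simp)

lemma direction_surjective (h : IsPolarChart x e) : Function.Surjective h.direction := by
  intro y
  obtain ⟨c, rfl⟩ := SeparationQuotient.surjective_mk y
  obtain ⟨u, hu, rfl⟩ := h.exists_eq_ray c
  exact ⟨⟨u, by simpa using hu⟩, rfl⟩

lemma continuous_direction (h : IsPolarChart x e) : Continuous h.direction := by
  rw [continuous_iff_continuousAt]
  intro u
  rw [ContinuousAt, tendsto_iff_dist_tendsto_zero]
  simp_rw [h.dist_direction]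
  have hne : ∀ v : Metric.sphere (0 : V) 1, (v : V) ≠ 0 := fun v => by
    intro h0
    have := mem_sphere_zero_iff_norm.1 v.2
    rw [h0, norm_zero] at this
    exact zero_ne_one this
  have h1 : Tendsto (fun v : Metric.sphere (0 : V) 1 => InnerProductGeometry.angle (v : V) u) (𝓝 u)
      (𝓝 (InnerProductGeometry.angle (u : V) u)) := by
    have h2 := InnerProductGeometry.continuousAt_angle (x := ((u : V), (u : V))) (hne u) (hne u)
    have h3 : ContinuousAt (fun v : Metric.sphere (0 : V) 1 => ((v : V), (u : V))) u := by
      fun_prop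
    exact ContinuousAt.comp (f := fun v : Metric.sphere (0 : V) 1 => ((v : V), (u : V))) h2 h3
  rwa [InnerProductGeometry.angle_self (hne u)] at h1

lemma direction_injective (h : IsPolarChart x e) : Function.Injective h.direction := by
  intro u v huv
  have h1 := h.dist_direction u v
  rw [huv, dist_self, eq_comm, InnerProductGeometry.angle_eq_zero_iff] at h1
  obtain ⟨-, r, hr, hv⟩ := h1
  have h2 := mem_sphere_zero_iff_norm.1 v.2
  rw [hv, norm_smul, mem_sphere_zero_iff_norm.1 u.2, mul_one, Real.norm_of_nonneg hr.le] at h2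
  apply Subtype.ext
  rw [hv, h2, one_smul]

/-- The unit vector pointing in a given direction. -/
def unitVector (h : IsPolarChart x e) (y : SpaceOfDirections x) : Metric.sphere (0 : V) 1 :=
  Function.surjInv h.direction_surjective y

@[simp] lemma direction_unitVector (h : IsPolarChart x e) (y : SpaceOfDirections x) :
    h.direction (h.unitVector y) = y := Function.surjInv_eq h.direction_surjective y

@[simp] lemma unitVector_direction (h : IsPolarChart x e) (u : Metric.sphere (0 : V) 1) :
    h.unitVector (h.direction u) = u := h.direction_injective (h.direction_unitVector _)

lemma norm_unitVector (h : IsPolarChart x e) (y : SpaceOfDirections x) :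
    ‖(h.unitVector y : V)‖ = 1 := mem_sphere_zero_iff_norm.1 (h.unitVector y).2

lemma angle_unitVector (h : IsPolarChart x e) (y z : SpaceOfDirections x) :
    InnerProductGeometry.angle (h.unitVector y : V) (h.unitVector z) = dist y z := by
  rw [← h.dist_direction, h.direction_unitVector, h.direction_unitVector]

lemma inner_unitVector (h : IsPolarChart x e) (y z : SpaceOfDirections x) :
    inner ℝ (h.unitVector y : V) (h.unitVector z) = Real.cos (min (dist y z) Real.pi) := by
  rw [← h.angle_unitVector, min_eq_left (InnerProductGeometry.angle_le_pi _ _),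
    InnerProductGeometry.cos_angle, h.norm_unitVector, h.norm_unitVector]
  simp

lemma continuous_unitVector (h : IsPolarChart x e) : Continuous h.unitVector := by
  have hl : LipschitzWith 1 h.unitVector := by
    apply LipschitzWith.of_dist_le_mul
    intro y z
    rw [NNReal.coe_one, one_mul, Subtype.dist_eq, dist_eq_norm]
    have h1 : ‖(h.unitVector y : V) - h.unitVector z‖ ^ 2 = 2 - 2 * Real.cos (dist y z) := by
      rw [norm_sub_sq_real, h.norm_unitVector, h.norm_unitVector, h.inner_unitVector,
        min_eq_left (by rw [← h.angle_unitVector]; exact InnerProductGeometry.angle_le_pi _ _)]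
      ring
    have h2 := Real.one_sub_sq_div_two_le_cos (x := dist y z)
    exact (abs_le_of_sq_le_sq' (by linarith) dist_nonneg).2
  exact hl.continuous

/-- The vector represented by a point of the tangent cone. -/
def tangentVector (h : IsPolarChart x e) : TangentCone x → V
  | .apex => 0
  | .ray r _ y => r • (h.unitVector y : V)

lemma isometry_tangentVector (h : IsPolarChart x e) : Isometry h.tangentVector := by
  apply Isometry.of_dist_eq
  intro p q
  cases p with
  | apex =>
    cases q with
    | apex => exact dist_self _
    | ray s hs z =>
      change dist 0 (s • (h.unitVector z : V)) = s
      rw [dist_zero_left, norm_smul, h.norm_unitVector, Real.norm_of_nonneg hs.le, mul_one]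
  | ray r hr y =>
    cases q with
    | apex =>
      change dist (r • (h.unitVector y : V)) 0 = r
      rw [dist_zero_right, norm_smul, h.norm_unitVector, Real.norm_of_nonneg hr.le, mul_one]
    | ray s hs z =>
      change dist (r • (h.unitVector y : V)) (s • (h.unitVector z : V)) =
          eucSide r s (min (dist y z) Real.pi)
      rw [dist_eq_norm, ← Real.sqrt_sq (norm_nonneg (r • _ - _)),
        norm_sub_sq_real, eucSide, ← h.inner_unitVector, norm_smul, norm_smul,
        real_inner_smul_left, real_inner_smul_right, h.norm_unitVector, h.norm_unitVector,
        Real.norm_of_nonneg hs.le, Real.norm_of_nonneg hr.le]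
      congr 1; ring

lemma tangentVector_surjective (h : IsPolarChart x e) : Function.Surjective h.tangentVector := by
  intro v
  rcases eq_or_ne v 0 with rfl | hv
  · exact ⟨.apex, rfl⟩
  · have hv' : 0 < ‖v‖ := norm_pos_iff.2 hv
    have hu : ‖v‖⁻¹ • v ∈ Metric.sphere (0 : V) 1 := by
      rw [mem_sphere_zero_iff_norm, norm_smul, norm_inv, norm_norm, inv_mul_cancel₀ hv'.ne']
    refine ⟨.ray ‖v‖ hv' (h.direction ⟨_, hu⟩), ?_⟩
    simp [tangentVector, smul_smul, mul_inv_cancel₀ hv'.ne']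

/-- The tangent cone at the centre of a polar chart is the model inner product space. -/
def tangentConeEquiv (h : IsPolarChart x e) : TangentCone x ≃ᵢ V :=
  IsometryEquiv.mk (Equiv.ofBijective h.tangentVector
    ⟨h.isometry_tangentVector.injective, h.tangentVector_surjective⟩) h.isometry_tangentVector

lemma tangentConeEquiv_apex (h : IsPolarChart x e) : h.tangentConeEquiv .apex = 0 := rfl

end IsPolarChart

end PolarChart

/-! ### Hyperbolic trigonometry -/

/-- The function `u ↦ cosh √u` is convex on `[0, ∞)`: its power series has nonnegative
coefficients. -/
lemma cosh_sqrt_convex {u v k : ℝ} (hu : 0 ≤ u) (hv : 0 ≤ v) (hk : 0 ≤ k) (hk1 : k ≤ 1) :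
    Real.cosh √(k * u + (1 - k) * v) ≤ k * Real.cosh √u + (1 - k) * Real.cosh √v := by
  have hs : ∀ w : ℝ, 0 ≤ w → HasSum (fun n : ℕ => w ^ n / ((2 * n).factorial : ℝ))
      (Real.cosh √w) := by
    intro w hw
    have := Real.hasSum_cosh √w
    simpa only [pow_mul, Real.sq_sqrt hw] using this
  have hk' : 0 ≤ 1 - k := by linarith
  refine hasSum_le (fun n => ?_) (hs _ (by positivity))
    (((hs u hu).mul_left k).add ((hs v hv).mul_left (1 - k)))
  have := (convexOn_pow n).2 (x := u) hu (y := v) hv hk hk' (by ring)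
  simp only [smul_eq_mul] at this
  rw [← mul_div_assoc, ← mul_div_assoc, ← add_div]
  gcongr

lemma sinh_le_mul_cosh {x : ℝ} (hx : 0 ≤ x) : Real.sinh x ≤ x * Real.cosh x := by
  refine hasSum_le (fun n => ?_) (Real.hasSum_sinh x) ((Real.hasSum_cosh x).mul_left x)
  rw [← mul_div_assoc, ← pow_succ']
  gcongr
  omega

lemma sinh_sq_le (x : ℝ) : Real.sinh x ^ 2 ≤ x ^ 2 * Real.cosh x ^ 2 := by
  have := sinh_le_mul_cosh (abs_nonneg x)
  have h2 := pow_le_pow_left₀ (Real.sinh_nonneg_iff.2 (abs_nonneg x)) this 2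
  rw [mul_pow, sq_abs, Real.cosh_abs] at h2
  rcases abs_choice x with h | h <;> rw [h] at h2
  · exact h2
  · rwa [Real.sinh_neg, neg_sq] at h2

lemma eq_of_cosh_eq {x y : ℝ} (hx : 0 ≤ x) (hy : 0 ≤ y) (h : Real.cosh x = Real.cosh y) :
    x = y := by
  have h1 := le_antisymm (Real.cosh_le_cosh.1 h.le) (Real.cosh_le_cosh.1 h.ge)
  rwa [abs_of_nonneg hx, abs_of_nonneg hy] at h1

/-- A side of a hyperbolic triangle is at least the corresponding side of the planar triangle with
the same two adjacent sides and the same angle. -/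
lemma euclidean_le_hyperbolic {a b c D : ℝ} (hD : 0 ≤ D) (hc : |c| ≤ 1)
    (h : Real.cosh D = Real.cosh a * Real.cosh b - Real.sinh a * Real.sinh b * c) :
    a ^ 2 + b ^ 2 - 2 * a * b * c ≤ D ^ 2 := by
  obtain ⟨hc1, hc2⟩ := abs_le.1 hc
  have h1 := cosh_sqrt_convex (sq_nonneg (a - b)) (sq_nonneg (a + b)) (k := (1 + c) / 2)
    (by linarith) (by linarith)
  rw [Real.sqrt_sq_eq_abs, Real.sqrt_sq_eq_abs, Real.cosh_abs, Real.cosh_abs, Real.cosh_add,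
    Real.cosh_sub] at h1
  have h2 : (1 + c) / 2 * (a - b) ^ 2 + (1 - (1 + c) / 2) * (a + b) ^ 2 =
      a ^ 2 + b ^ 2 - 2 * a * b * c := by ring
  rw [h2] at h1
  have h3 : Real.cosh √(a ^ 2 + b ^ 2 - 2 * a * b * c) ≤ Real.cosh D := by
    rw [h]; refine h1.trans_eq ?_; ring
  rw [Real.cosh_le_cosh, abs_of_nonneg (Real.sqrt_nonneg _), abs_of_nonneg hD] at h3
  exact (Real.sqrt_le_left hD).1 h3

/-- Conversely, the square of a side of a hyperbolic triangle exceeds that of the planar one at most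
by the factor `cosh a cosh b`, which tends to `1` for small triangles. -/
lemma hyperbolic_le_euclidean {a b c D : ℝ} (ha : 0 ≤ a) (hb : 0 ≤ b) (hD : 0 ≤ D) (hc : |c| ≤ 1)
    (h : Real.cosh D = Real.cosh a * Real.cosh b - Real.sinh a * Real.sinh b * c) :
    D ^ 2 ≤ Real.cosh a * Real.cosh b * (a ^ 2 + b ^ 2 - 2 * a * b * c) := by
  obtain ⟨hc1, hc2⟩ := abs_le.1 hc
  have half : ∀ x : ℝ, 2 * (Real.cosh x - 1) = 4 * Real.sinh (x / 2) ^ 2 := by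
    intro x
    have h1 := Real.cosh_two_mul (x / 2)
    have h2 := Real.cosh_sq (x / 2)
    rw [mul_div_cancel₀ _ two_ne_zero] at h1
    linarith
  have half' : ∀ x : ℝ, Real.cosh (x / 2) ^ 2 = (1 + Real.cosh x) / 2 := by
    intro x
    have h1 := half x
    have h2 := Real.cosh_sq (x / 2)
    linarith
  have h1 : D ^ 2 ≤ 2 * (Real.cosh D - 1) := by
    rw [half]
    have := Real.self_le_sinh_iff.2 (by positivity : 0 ≤ D / 2)
    nlinarith
  have h2 : 2 * (Real.cosh (a - b) - 1) ≤ (a - b) ^ 2 * (Real.cosh a * Real.cosh b) := by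
    have e1 := sinh_sq_le ((a - b) / 2)
    rw [half'] at e1
    have e2 := Real.one_le_cosh a
    have e3 := Real.one_le_cosh b
    have e4 := Real.sinh_nonneg_iff.2 ha
    have e5 := Real.sinh_nonneg_iff.2 hb
    have e6 : (1 + Real.cosh (a - b)) / 2 ≤ Real.cosh a * Real.cosh b := by
      rw [Real.cosh_sub]; nlinarith [mul_nonneg e4 e5]
    rw [half]
    nlinarith [mul_le_mul_of_nonneg_left e6 (sq_nonneg (a - b))]
  have h3 : Real.sinh a * Real.sinh b ≤ a * b * (Real.cosh a * Real.cosh b) := by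
    have := mul_le_mul (sinh_le_mul_cosh ha) (sinh_le_mul_cosh hb) (Real.sinh_nonneg_iff.2 hb)
      (mul_nonneg ha (Real.cosh_pos a).le)
    linarith
  rw [Real.cosh_sub] at h2
  nlinarith [mul_le_mul_of_nonneg_right h3 (by linarith : 0 ≤ 1 - c)]

/-! ### The exponential map of the hyperbolic plane -/

/-- The Euclidean plane, as the model of the tangent planes of the hyperbolic plane. -/
abbrev Plane : Type := EuclideanSpace ℝ (Fin 2)

lemma plane_inner (v w : Plane) : inner ℝ v w = v 0 * w 0 + v 1 * w 1 := by
  rw [PiLp.inner_apply, Fin.sum_univ_two]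
  simp [mul_comm]

lemma plane_norm_sq (v : Plane) : ‖v‖ ^ 2 = v 0 ^ 2 + v 1 ^ 2 := by
  rw [← real_inner_self_eq_norm_sq, plane_inner]; ring

lemma plane_unit_sq {v : Plane} (hv : v ≠ 0) : (v 0 / ‖v‖) ^ 2 + (v 1 / ‖v‖) ^ 2 = 1 := by
  have : 0 < ‖v‖ := norm_pos_iff.2 hv
  rw [div_pow, div_pow, ← add_div, ← plane_norm_sq, div_self (by positivity)]

/-- The coordinates `(cosh r, sinh r cos θ, sinh r sin θ)` of the vector with polar coordinates
`(r, θ)` lie on the hyperboloid. At the origin `v i / ‖v‖` has the junk value `0`, which is harmless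
since `sinh ‖v‖ = 0` there. -/
lemma hyperboloid_coords (v : Plane) : Real.cosh ‖v‖ ^ 2 -
    (Real.sinh ‖v‖ * (v 0 / ‖v‖)) ^ 2 - (Real.sinh ‖v‖ * (v 1 / ‖v‖)) ^ 2 = 1 := by
  rw [Real.cosh_sq]
  rcases eq_or_ne v 0 with rfl | hv
  · simp
  · linear_combination (-Real.sinh ‖v‖ ^ 2) * plane_unit_sq hv

lemma horocycle_pos (v : Plane) : 0 < Real.cosh ‖v‖ - Real.sinh ‖v‖ * (v 0 / ‖v‖) := by
  have h1 := hyperboloid_coords v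
  have h2 := Real.cosh_pos ‖v‖
  nlinarith [sq_nonneg (Real.sinh ‖v‖ * (v 1 / ‖v‖)), sq_nonneg (Real.sinh ‖v‖ * (v 0 / ‖v‖))]

/-- The exponential map of the hyperbolic plane at `p`. The point with polar coordinates `(r, θ)` is
the point `(cosh r, sinh r cos θ, sinh r sin θ) = (X₀, X₁, X₂)` of the hyperboloid, which becomes
the point `(X₂ + i) / (X₀ - X₁)` of the upper half-plane and is then moved by the affine map that
sends `i` to `p`. -/
def hexp (p : UpperHalfPlane) (v : Plane) : UpperHalfPlane :=
  ⟨⟨p.re + p.im * (Real.sinh ‖v‖ * (v 1 / ‖v‖)) / (Real.cosh ‖v‖ - Real.sinh ‖v‖ * (v 0 / ‖v‖)),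
    p.im / (Real.cosh ‖v‖ - Real.sinh ‖v‖ * (v 0 / ‖v‖))⟩, div_pos p.im_pos (horocycle_pos v)⟩

lemma hexp_re (p : UpperHalfPlane) (v : Plane) : (hexp p v).re = p.re +
    p.im * (Real.sinh ‖v‖ * (v 1 / ‖v‖)) / (Real.cosh ‖v‖ - Real.sinh ‖v‖ * (v 0 / ‖v‖)) := rfl

lemma hexp_im (p : UpperHalfPlane) (v : Plane) : (hexp p v).im =
    p.im / (Real.cosh ‖v‖ - Real.sinh ‖v‖ * (v 0 / ‖v‖)) := rfl

/-- The hyperbolic law of cosines. -/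
lemma cosh_dist_hexp (p : UpperHalfPlane) (v w : Plane) :
    Real.cosh (dist (hexp p v) (hexp p w)) = Real.cosh ‖v‖ * Real.cosh ‖w‖ -
      Real.sinh ‖v‖ * Real.sinh ‖w‖ * Real.cos (InnerProductGeometry.angle v w) := by
  have hv := hyperboloid_coords v
  have hw := hyperboloid_coords w
  have hv0 := horocycle_pos v
  have hw0 := horocycle_pos w
  have hp := p.im_pos
  have hangle : Real.cos (InnerProductGeometry.angle v w) =
      (v 0 / ‖v‖) * (w 0 / ‖w‖) + (v 1 / ‖v‖) * (w 1 / ‖w‖) := by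
    rw [InnerProductGeometry.cos_angle, plane_inner, add_div, mul_div_mul_comm, mul_div_mul_comm]
  have hd : dist (hexp p v : ℂ) (hexp p w) ^ 2 =
      ((hexp p v).re - (hexp p w).re) ^ 2 + ((hexp p v).im - (hexp p w).im) ^ 2 := by
    rw [Complex.dist_eq, Complex.sq_norm, Complex.normSq_apply]
    simp only [Complex.sub_re, Complex.sub_im, UpperHalfPlane.coe_re, UpperHalfPlane.coe_im]
    ring
  rw [UpperHalfPlane.cosh_dist, hd, hangle]
  simp only [hexp_re, hexp_im]
  rw [show Real.sinh ‖v‖ * Real.sinh ‖w‖ * ((v 0 / ‖v‖) * (w 0 / ‖w‖) + (v 1 / ‖v‖) * (w 1 / ‖w‖)) =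
    (Real.sinh ‖v‖ * (v 0 / ‖v‖)) * (Real.sinh ‖w‖ * (w 0 / ‖w‖)) +
    (Real.sinh ‖v‖ * (v 1 / ‖v‖)) * (Real.sinh ‖w‖ * (w 1 / ‖w‖)) by ring]
  generalize Real.sinh ‖v‖ * (v 0 / ‖v‖) = X1 at *
  generalize Real.sinh ‖v‖ * (v 1 / ‖v‖) = X2 at *
  generalize Real.sinh ‖w‖ * (w 0 / ‖w‖) = Y1 at *
  generalize Real.sinh ‖w‖ * (w 1 / ‖w‖) = Y2 at *
  generalize Real.cosh ‖v‖ = X0 at *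
  generalize Real.cosh ‖w‖ = Y0 at *
  obtain ⟨A, rfl⟩ : ∃ A, X0 = X1 + A := ⟨X0 - X1, by ring⟩
  obtain ⟨B, rfl⟩ : ∃ B, Y0 = Y1 + B := ⟨Y0 - Y1, by ring⟩
  rw [add_sub_cancel_left] at hv0 hw0 ⊢
  rw [add_sub_cancel_left]
  have hX1 : X1 = (1 + X2 ^ 2 - A ^ 2) / (2 * A) := by
    rw [eq_div_iff (by positivity)]; linarith
  have hY1 : Y1 = (1 + Y2 ^ 2 - B ^ 2) / (2 * B) := by
    rw [eq_div_iff (by positivity)]; linarith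
  rw [hX1, hY1]
  field_simp
  ring

lemma norm_sub_sq_eq_cos (v w : Plane) : ‖v - w‖ ^ 2 = ‖v‖ ^ 2 + ‖w‖ ^ 2 -
    2 * ‖v‖ * ‖w‖ * Real.cos (InnerProductGeometry.angle v w) := by
  rw [norm_sub_sq_real, ← InnerProductGeometry.cos_angle_mul_norm_mul_norm]; ring

lemma norm_sub_le_dist_hexp (p : UpperHalfPlane) (v w : Plane) :
    ‖v - w‖ ≤ dist (hexp p v) (hexp p w) := by
  have h := euclidean_le_hyperbolic dist_nonneg (Real.abs_cos_le_one _) (cosh_dist_hexp p v w)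
  rw [← norm_sub_sq_eq_cos] at h
  exact (abs_le_of_sq_le_sq' h dist_nonneg).2

lemma dist_hexp_sq_le (p : UpperHalfPlane) (v w : Plane) :
    dist (hexp p v) (hexp p w) ^ 2 ≤ Real.cosh ‖v‖ * Real.cosh ‖w‖ * ‖v - w‖ ^ 2 := by
  rw [norm_sub_sq_eq_cos]
  exact hyperbolic_le_euclidean (norm_nonneg _) (norm_nonneg _) dist_nonneg
    (Real.abs_cos_le_one _) (cosh_dist_hexp p v w)

lemma dist_hexp_neg (p : UpperHalfPlane) (v w : Plane) :
    dist (hexp p (-v)) (hexp p (-w)) = dist (hexp p v) (hexp p w) := by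
  have h := cosh_dist_hexp p (-v) (-w)
  rw [norm_neg, norm_neg, InnerProductGeometry.angle_neg_neg, ← cosh_dist_hexp] at h
  exact eq_of_cosh_eq dist_nonneg dist_nonneg h

lemma hexp_zero (p : UpperHalfPlane) : hexp p 0 = p := by
  apply UpperHalfPlane.ext
  apply Complex.ext
  · change (hexp p 0).re = p.re
    rw [hexp_re]; simp
  · change (hexp p 0).im = p.im
    rw [hexp_im]; simp

lemma dist_self_hexp (p : UpperHalfPlane) (v : Plane) : dist p (hexp p v) = ‖v‖ := by
  have h := cosh_dist_hexp p 0 v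
  rw [hexp_zero, norm_zero, Real.cosh_zero, Real.sinh_zero, zero_mul, zero_mul, sub_zero,
    one_mul] at h
  exact eq_of_cosh_eq dist_nonneg (norm_nonneg _) h

lemma continuous_hexp (p : UpperHalfPlane) : Continuous (hexp p) := by
  rw [continuous_iff_continuousAt]
  intro v
  rw [ContinuousAt, tendsto_iff_dist_tendsto_zero]
  have h : Tendsto (fun w : Plane => √(Real.cosh ‖w‖ * Real.cosh ‖v‖ * ‖w - v‖ ^ 2)) (𝓝 v)
      (𝓝 0) := by
    have : Continuous (fun w : Plane => √(Real.cosh ‖w‖ * Real.cosh ‖v‖ * ‖w - v‖ ^ 2)) := by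
      have := Real.continuous_cosh
      fun_prop
    simpa using this.tendsto v
  exact squeeze_zero (fun _ => dist_nonneg)
    (fun w => Real.le_sqrt_of_sq_le (dist_hexp_sq_le p w v)) h

/-- The inverse of the exponential map of the hyperbolic plane, in two variables. -/
def hlog (p z : UpperHalfPlane) : Plane :=
  let X2 := (z.re - p.re) / z.im
  let X1 := ((X2 ^ 2 + 1) * (z.im / p.im) - p.im / z.im) / 2
  (Real.arsinh √(X1 ^ 2 + X2 ^ 2) / √(X1 ^ 2 + X2 ^ 2)) • !₂[X1, X2]

/-- Writing `X₀² = 1 + X₁² + X₂²`, the coordinates `X₀ - X₁ = p.im / z.im` and `X₂` determine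
`X₀ + X₁ = (X₂² + 1) / (X₀ - X₁)`, which explains the value of `X1` in `hlog`. -/
lemma hexp_hlog (p z : UpperHalfPlane) : hexp p (hlog p z) = z := by
  have hp := p.im_pos
  have hz := z.im_pos
  set X2 := (z.re - p.re) / z.im with hX2
  set X1 := ((X2 ^ 2 + 1) * (z.im / p.im) - p.im / z.im) / 2 with hX1
  set R := √(X1 ^ 2 + X2 ^ 2) with hR
  have hlog_eq : hlog p z = (Real.arsinh R / R) • !₂[X1, X2] := rfl
  have hR0 : 0 ≤ R := Real.sqrt_nonneg _
  have hR2 : R ^ 2 = X1 ^ 2 + X2 ^ 2 := Real.sq_sqrt (by positivity)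
  have hA0 : 0 ≤ Real.arsinh R := Real.arsinh_nonneg_iff.2 hR0
  have c0 : hlog p z 0 = Real.arsinh R / R * X1 := by rw [hlog_eq]; simp
  have c1 : hlog p z 1 = Real.arsinh R / R * X2 := by rw [hlog_eq]; simp
  have hnorm : ‖hlog p z‖ = Real.arsinh R := by
    have h1 : ‖hlog p z‖ ^ 2 = Real.arsinh R ^ 2 := by
      rw [plane_norm_sq, c0, c1]
      rcases eq_or_ne R 0 with h0 | h0
      · rw [h0]; simp
      · field_simp
        rw [hR2]
    rwa [sq_eq_sq₀ (norm_nonneg _) hA0] at h1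
  have hu : ∀ X : ℝ, X ^ 2 ≤ R ^ 2 →
      R * (Real.arsinh R / R * X / Real.arsinh R) = X := by
    intro X hX
    rcases eq_or_ne R 0 with h0 | h0
    · have : X = 0 := by
        rw [h0] at hX
        exact pow_eq_zero_iff two_ne_zero |>.1 (le_antisymm (by simpa using hX) (sq_nonneg _))
      rw [this, h0]; simp
    · have : Real.arsinh R ≠ 0 := by rwa [Ne, Real.arsinh_eq_zero_iff]
      field_simp
  have s1 : Real.sinh ‖hlog p z‖ * (hlog p z 0 / ‖hlog p z‖) = X1 := by
    rw [hnorm, c0, Real.sinh_arsinh]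
    exact hu X1 (by rw [hR2]; nlinarith [sq_nonneg X2])
  have s2 : Real.sinh ‖hlog p z‖ * (hlog p z 1 / ‖hlog p z‖) = X2 := by
    rw [hnorm, c1, Real.sinh_arsinh]
    exact hu X2 (by rw [hR2]; nlinarith [sq_nonneg X1])
  have hch : Real.cosh ‖hlog p z‖ = X1 + p.im / z.im := by
    rw [hnorm, Real.cosh_arsinh, hR2]
    have hA : 2 * X1 = (X2 ^ 2 + 1) * (z.im / p.im) - p.im / z.im := by rw [hX1]; ring
    have hy : z.im / p.im * (p.im / z.im) = 1 := by field_simp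
    have e : 1 + (X1 ^ 2 + X2 ^ 2) = (X1 + p.im / z.im) ^ 2 := by
      linear_combination (-(p.im / z.im)) * hA - (X2 ^ 2 + 1) * hy
    rw [e, Real.sqrt_sq]
    have h1 : 0 < z.im / p.im := by positivity
    have h2 : 0 < p.im / z.im := by positivity
    have h3 : 0 ≤ (X2 ^ 2 + 1) * (z.im / p.im) := by positivity
    linarith
  have hsub : Real.cosh ‖hlog p z‖ - X1 = p.im / z.im := by rw [hch]; ring
  apply UpperHalfPlane.ext
  apply Complex.ext
  · change (hexp p (hlog p z)).re = z.re
    rw [hexp_re, s1, s2, hsub, hX2]; field_simp; ring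
  · change (hexp p (hlog p z)).im = z.im
    rw [hexp_im, s1, hsub]; field_simp

lemma measurable_hexp : Measurable (Function.uncurry hexp) := by
  have hre : Measurable UpperHalfPlane.re :=
    Complex.measurable_re.comp UpperHalfPlane.measurable_coe
  have him : Measurable UpperHalfPlane.im :=
    Complex.measurable_im.comp UpperHalfPlane.measurable_coe
  refine UpperHalfPlane.measurableEmbedding_coe.measurable_comp_iff.1 ?_
  refine measurable_of_re_im ?_ ?_
  · change Measurable fun a : UpperHalfPlane × Plane => (hexp a.1 a.2).re
    simp only [hexp_re]
    fun_prop
  · change Measurable fun a : UpperHalfPlane × Plane => (hexp a.1 a.2).im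
    simp only [hexp_im]
    fun_prop

lemma measurable_hlog : Measurable (Function.uncurry hlog) := by
  have hre : Measurable UpperHalfPlane.re :=
    Complex.measurable_re.comp UpperHalfPlane.measurable_coe
  have him : Measurable UpperHalfPlane.im :=
    Complex.measurable_im.comp UpperHalfPlane.measurable_coe
  have harsinh : Measurable Real.arsinh := Real.continuous_arsinh.measurable
  have hX2 : Measurable fun a : UpperHalfPlane × UpperHalfPlane =>
      (a.2.re - a.1.re) / a.2.im := by fun_prop
  have hX1 : Measurable fun a : UpperHalfPlane × UpperHalfPlane =>
      ((((a.2.re - a.1.re) / a.2.im) ^ 2 + 1) * (a.2.im / a.1.im) - a.1.im / a.2.im) / 2 := by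
    fun_prop
  have hR := ((hX1.pow_const 2).add (hX2.pow_const 2)).sqrt
  refine ((harsinh.comp hR).div hR).smul (f := fun a => _) ?_
  have : Measurable fun a : ℝ × ℝ => !₂[a.1, a.2] := by fun_prop
  exact this.comp (hX1.prodMk hX2)

/-- Vectors at `p` that point to the endpoints of a segment through `p` are antiparallel. -/
lemma inner_eq_of_dist_hexp (p : UpperHalfPlane) {v w : Plane}
    (h : dist (hexp p v) (hexp p w) = ‖v‖ + ‖w‖) : inner ℝ v w = -(‖v‖ * ‖w‖) := by
  rcases eq_or_ne v 0 with rfl | hv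
  · simp
  rcases eq_or_ne w 0 with rfl | hw
  · simp
  have h1 := cosh_dist_hexp p v w
  rw [h, Real.cosh_add] at h1
  have h2 := Real.sinh_pos_iff.2 (norm_pos_iff.2 hv)
  have h3 := Real.sinh_pos_iff.2 (norm_pos_iff.2 hw)
  have h4 : Real.cos (InnerProductGeometry.angle v w) = -1 := by
    have h5 : 0 < Real.sinh ‖v‖ * Real.sinh ‖w‖ := mul_pos h2 h3
    have : Real.sinh ‖v‖ * Real.sinh ‖w‖ * Real.cos (InnerProductGeometry.angle v w) =
      Real.sinh ‖v‖ * Real.sinh ‖w‖ * (-1) := by linarith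
    exact mul_left_cancel₀ h5.ne' this
  rw [← InnerProductGeometry.cos_angle_mul_norm_mul_norm, h4]; ring

lemma dist_hexp_smul (p : UpperHalfPlane) (v : Plane) {l : ℝ} (hl : 0 ≤ l) (hl1 : l ≤ 1) :
    dist (hexp p (l • v)) (hexp p v) = (1 - l) * ‖v‖ := by
  have hn : ‖l • v‖ = l * ‖v‖ := by rw [norm_smul, Real.norm_of_nonneg hl]
  have hl' : 0 ≤ 1 - l := by linarith
  have h : Real.cosh (dist (hexp p (l • v)) (hexp p v)) = Real.cosh ((1 - l) * ‖v‖) := by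
    rw [cosh_dist_hexp, hn, show (1 - l) * ‖v‖ = ‖v‖ - l * ‖v‖ by ring, Real.cosh_sub]
    rcases eq_or_ne v 0 with rfl | hv
    · simp
    rcases hl.eq_or_lt with rfl | hl0
    · simp
    rw [InnerProductGeometry.angle_smul_left_of_pos _ _ hl0, InnerProductGeometry.angle_self hv,
      Real.cos_zero]
    ring
  exact eq_of_cosh_eq dist_nonneg (by positivity) h

/-- The CAT(0) inequality: in a polar chart at the point of the segment, both endpoints lie on a
line through the origin, and the chart does not decrease distances. -/
lemma hexp_convexity (p : UpperHalfPlane) (v : Plane) (z : UpperHalfPlane) (l : ℝ) (hl : 0 ≤ l)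
    (hl1 : l ≤ 1) : dist (hexp p (l • v)) z ^ 2 ≤
      (1 - l) * dist p z ^ 2 + l * dist (hexp p v) z ^ 2 - l * (1 - l) * ‖v‖ ^ 2 := by
  set q := hexp p (l • v) with hq
  set a := hlog q p with ha
  set b := hlog q (hexp p v) with hb
  set c := hlog q z with hc
  have ea : hexp q a = p := hexp_hlog _ _
  have eb : hexp q b = hexp p v := hexp_hlog _ _
  have ec : hexp q c = z := hexp_hlog _ _
  have na : ‖a‖ = l * ‖v‖ := by
    rw [← dist_self_hexp q, ea, hq, dist_comm, dist_self_hexp, norm_smul, Real.norm_of_nonneg hl]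
  have nb : ‖b‖ = (1 - l) * ‖v‖ := by
    rw [← dist_self_hexp q, eb, hq, dist_hexp_smul p v hl hl1]
  have hab := inner_eq_of_dist_hexp q (v := a) (w := b) (by
    rw [ea, eb, dist_self_hexp, na, nb]; ring)
  have hz : (1 - l) • a + l • b = 0 := by
    rw [← norm_eq_zero, ← pow_eq_zero_iff two_ne_zero, norm_add_sq_real, norm_smul, norm_smul,
      real_inner_smul_left, real_inner_smul_right, hab, na, nb, Real.norm_of_nonneg hl,
      Real.norm_of_nonneg (by linarith : 0 ≤ 1 - l)]
    ring
  have h1 := pow_le_pow_left₀ (norm_nonneg _) (norm_sub_le_dist_hexp q a c) 2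
  have h2 := pow_le_pow_left₀ (norm_nonneg _) (norm_sub_le_dist_hexp q b c) 2
  rw [ea, ec, norm_sub_sq_real, na] at h1
  rw [eb, ec, norm_sub_sq_real, nb] at h2
  have h3 : (1 - l) * inner ℝ a c + l * inner ℝ b c = 0 := by
    rw [← real_inner_smul_left, ← real_inner_smul_left, ← inner_add_left, hz, inner_zero_left]
  have h4 : dist q z = ‖c‖ := by rw [← ec, dist_self_hexp]
  rw [h4]
  nlinarith [mul_le_mul_of_nonneg_left h1 (by linarith : 0 ≤ 1 - l),
    mul_le_mul_of_nonneg_left h2 hl]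

lemma tendsto_dist_hexp (p : UpperHalfPlane) (v w : Plane) :
    Tendsto (fun s : ℝ => dist (hexp p (s • v)) (hexp p (s • w)) ^ 2 / s ^ 2) (𝓝[>] 0)
      (𝓝 (‖v - w‖ ^ 2)) := by
  have h : Tendsto (fun s : ℝ => Real.cosh ‖s • v‖ * Real.cosh ‖s • w‖ * ‖v - w‖ ^ 2) (𝓝[>] 0)
      (𝓝 (‖v - w‖ ^ 2)) := by
    have : Continuous (fun s : ℝ => Real.cosh ‖s • v‖ * Real.cosh ‖s • w‖ * ‖v - w‖ ^ 2) := by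
      have := Real.continuous_cosh
      fun_prop
    have h2 := this.tendsto 0
    simp only [zero_smul, norm_zero, Real.cosh_zero, one_mul] at h2
    exact h2.mono_left nhdsWithin_le_nhds
  refine tendsto_of_tendsto_of_tendsto_of_le_of_le' tendsto_const_nhds h ?_ ?_
  · filter_upwards [self_mem_nhdsWithin] with s hs
    have hs' : 0 < s := hs
    rw [le_div_iff₀ (by positivity), ← mul_pow, mul_comm]
    have := norm_sub_le_dist_hexp p (s • v) (s • w)
    rw [← smul_sub, norm_smul, Real.norm_of_nonneg hs'.le] at this
    exact pow_le_pow_left₀ (by positivity) this 2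
  · filter_upwards [self_mem_nhdsWithin] with s hs
    have hs' : 0 < s := hs
    rw [div_le_iff₀ (by positivity)]
    have := dist_hexp_sq_le p (s • v) (s • w)
    rw [← smul_sub, norm_smul _ (v - w), Real.norm_of_nonneg hs'.le] at this
    linarith

/-- The exponential map of the hyperbolic plane is a polar chart. -/
theorem isPolarChart_hexp (p : UpperHalfPlane) : IsPolarChart p (hexp p) where
  surjective z := ⟨hlog p z, hexp_hlog p z⟩
  dist_center := dist_self_hexp p
  norm_sub_le := norm_sub_le_dist_hexp p
  convexity := hexp_convexity p
  tendsto := tendsto_dist_hexp p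

/-! ### Pythagorean integrals and `L²` spaces -/

section Integral

variable {Ω : Type*} [MeasurableSpace Ω] {μ : Measure Ω}

namespace PythagoreanIntegral

variable {Y : Type*} [MetricSpace Y] {o : Y}

lemma dist_sq (f g : PythagoreanIntegral μ o) :
    dist f g ^ 2 = ∫ t, dist (f.1 t) (g.1 t) ^ 2 ∂μ :=
  Real.sq_sqrt (integral_nonneg fun _ => sq_nonneg _)

/-- Distances are lower semicontinuous under almost everywhere convergence (Fatou's lemma). -/
lemma dist_le_of_tendsto_ae {f : ℕ → PythagoreanIntegral μ o} {g y : PythagoreanIntegral μ o}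
    (h : ∀ᵐ t ∂μ, Tendsto (fun n => (f n).1 t) atTop (𝓝 (y.1 t))) {C : ℝ}
    (hC : ∀ᶠ n in atTop, dist g (f n) ≤ C) : dist g y ≤ C := by
  have hC0 : 0 ≤ C := by
    obtain ⟨n, hn⟩ := hC.exists
    exact dist_nonneg.trans hn
  have hofReal : ∀ a b : PythagoreanIntegral μ o, ENNReal.ofReal (dist a b ^ 2) =
      ∫⁻ t, ENNReal.ofReal (dist (a.1 t) (b.1 t) ^ 2) ∂μ := fun a b => by
    rw [dist_sq, ofReal_integral_eq_lintegral_ofReal (a.integrable_dist_sq b)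
      (Eventually.of_forall fun _ => sq_nonneg _)]
  have key : ENNReal.ofReal (dist g y ^ 2) ≤ ENNReal.ofReal (C ^ 2) := by
    calc ENNReal.ofReal (dist g y ^ 2)
        = ∫⁻ t, liminf (fun n => ENNReal.ofReal (dist (g.1 t) ((f n).1 t) ^ 2)) atTop ∂μ := by
          rw [hofReal]
          apply lintegral_congr_ae
          filter_upwards [h] with t ht
          exact (Tendsto.liminf_eq (ENNReal.tendsto_ofReal
            ((tendsto_const_nhds.dist ht).pow 2))).symm
      _ ≤ liminf (fun n => ∫⁻ t, ENNReal.ofReal (dist (g.1 t) ((f n).1 t) ^ 2) ∂μ) atTop :=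
          lintegral_liminf_le' fun n => (g.integrable_dist_sq (f n)).1.aemeasurable.ennreal_ofReal
      _ ≤ ENNReal.ofReal (C ^ 2) := by
          refine liminf_le_of_le (by isBoundedDefault) fun b hb => ?_
          obtain ⟨n, hn, hn'⟩ := (hb.and hC).exists
          rw [← hofReal] at hn
          exact hn.trans (ENNReal.ofReal_le_ofReal (pow_le_pow_left₀ dist_nonneg hn' 2))
  rw [ENNReal.ofReal_le_ofReal_iff (sq_nonneg _)] at key
  exact (abs_le_of_sq_le_sq' key hC0).2

end PythagoreanIntegral

section Lp

variable {F : Type*} [NormedAddCommGroup F]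

lemma integrable_norm_sq (v : Lp F 2 μ) : Integrable (fun t => ‖v t‖ ^ 2) μ :=
  (memLp_two_iff_integrable_sq_norm (Lp.memLp v).1).1 (Lp.memLp v)

lemma norm_sq_eq_integral [InnerProductSpace ℝ F] (v : Lp F 2 μ) :
    ‖v‖ ^ 2 = ∫ t, ‖v t‖ ^ 2 ∂μ := by
  rw [← real_inner_self_eq_norm_sq, L2.inner_def]
  simp only [real_inner_self_eq_norm_sq]

lemma norm_sub_sq_eq_integral [InnerProductSpace ℝ F] (v w : Lp F 2 μ) :
    ‖v - w‖ ^ 2 = ∫ t, ‖v t - w t‖ ^ 2 ∂μ := by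
  rw [norm_sq_eq_integral]
  apply integral_congr_ae
  filter_upwards [Lp.coeFn_sub v w] with t ht
  rw [ht, Pi.sub_apply]

/-- An isometry of `Y` onto an inner product space that sends the base point to `0` identifies the
Pythagorean integral of `Y` with a space `L²`. -/
theorem exists_pythagoreanIntegral_equiv [InnerProductSpace ℝ F] {Y : Type*} [MetricSpace Y]
    {o : Y} (φ : Y ≃ᵢ F) (hφ : φ o = 0) :
    ∃ Φ : PythagoreanIntegral μ o ≃ᵢ Lp F 2 μ, ∀ f, ∀ᵐ t ∂μ, (Φ f) t = φ (f.1 t) := by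
  have hnorm : ∀ y, ‖φ y‖ = dist o y := fun y => by
    rw [← φ.isometry.dist_eq, hφ, dist_zero_left]
  have hmem : ∀ f : PythagoreanIntegral μ o,
      AEEqFun.comp φ φ.continuous f.1 ∈ Lp F 2 μ := by
    intro f
    rw [Lp.mem_Lp_iff_memLp, memLp_two_iff_integrable_sq_norm (AEEqFun.aestronglyMeasurable _)]
    refine f.2.congr ?_
    filter_upwards [AEEqFun.coeFn_comp φ φ.continuous f.1] with t ht
    rw [ht, Function.comp_apply, hnorm]
  have hmem' : ∀ v : Lp F 2 μ, Integrable (fun t =>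
      dist o ((AEEqFun.comp φ.symm φ.symm.continuous v.1 : Ω →ₘ[μ] Y) t) ^ 2) μ := by
    intro v
    refine (integrable_norm_sq v).congr ?_
    filter_upwards [AEEqFun.coeFn_comp φ.symm φ.symm.continuous v.1] with t ht
    rw [ht, Function.comp_apply, ← hnorm, φ.apply_symm_apply]
  have hcoe : ∀ f : PythagoreanIntegral μ o,
      (⟨_, hmem f⟩ : Lp F 2 μ) =ᵐ[μ] fun t => φ (f.1 t) := fun f =>
    AEEqFun.coeFn_comp φ φ.continuous f.1
  let Φ : PythagoreanIntegral μ o ≃ Lp F 2 μ :=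
    { toFun := fun f => ⟨_, hmem f⟩
      invFun := fun v => ⟨_, hmem' v⟩
      left_inv := fun f => by
        apply Subtype.ext
        apply AEEqFun.ext
        refine (AEEqFun.coeFn_comp φ.symm φ.symm.continuous _).trans ?_
        filter_upwards [AEEqFun.coeFn_comp φ φ.continuous f.1] with t ht
        rw [Function.comp_apply, ht, Function.comp_apply, φ.symm_apply_apply]
      right_inv := fun v => by
        apply Subtype.ext
        apply AEEqFun.ext
        refine (AEEqFun.coeFn_comp φ φ.continuous _).trans ?_
        filter_upwards [AEEqFun.coeFn_comp φ.symm φ.symm.continuous v.1] with t ht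
        rw [Function.comp_apply, ht, Function.comp_apply, φ.apply_symm_apply] }
  refine ⟨IsometryEquiv.mk Φ (Isometry.of_dist_eq fun f g => ?_), hcoe⟩
  rw [← sq_eq_sq₀ dist_nonneg dist_nonneg, dist_eq_norm, norm_sub_sq_eq_integral,
    PythagoreanIntegral.dist_sq]
  apply integral_congr_ae
  filter_upwards [hcoe f, hcoe g] with t hf hg
  change ‖(⟨_, hmem f⟩ : Lp F 2 μ) t - (⟨_, hmem g⟩ : Lp F 2 μ) t‖ ^ 2 = _
  rw [hf, hg, ← dist_eq_norm, φ.isometry.dist_eq]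

end Lp

/-! ### The exponential map of the Pythagorean integral of the hyperbolic plane -/

section Exp

variable {o : UpperHalfPlane}

/-- The exponential map of `L²(Ω, ℍ)` at `x`: the exponential maps at the points `x t`, applied
pointwise. -/
def l2exp (x : PythagoreanIntegral μ o) (v : Lp Plane 2 μ) : PythagoreanIntegral μ o :=
  ⟨AEEqFun.comp₂Measurable hexp measurable_hexp x.1 v.1, by
    refine ((x.2.const_mul 2).add ((integrable_norm_sq v).const_mul 2)).mono'
      (((aestronglyMeasurable_const.dist (AEEqFun.aestronglyMeasurable _))).pow 2) ?_
    filter_upwards [AEEqFun.coeFn_comp₂Measurable hexp measurable_hexp x.1 v.1] with t ht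
    rw [ht, Real.norm_of_nonneg (sq_nonneg _)]
    have h1 := dist_triangle o (x.1 t) (hexp (x.1 t) (v t))
    rw [dist_self_hexp] at h1
    have h2 := pow_le_pow_left₀ dist_nonneg h1 2
    refine h2.trans ?_
    simp only [Pi.add_apply]
    nlinarith [sq_nonneg (dist o (x.1 t) - ‖v t‖)]⟩

lemma coeFn_l2exp (x : PythagoreanIntegral μ o) (v : Lp Plane 2 μ) :
    (l2exp x v).1 =ᵐ[μ] fun t => hexp (x.1 t) (v t) :=
  AEEqFun.coeFn_comp₂Measurable hexp measurable_hexp x.1 v.1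

lemma coeFn_l2exp_smul (x : PythagoreanIntegral μ o) (s : ℝ) (v : Lp Plane 2 μ) :
    (l2exp x (s • v)).1 =ᵐ[μ] fun t => hexp (x.1 t) (s • v t) := by
  filter_upwards [coeFn_l2exp x (s • v), Lp.coeFn_smul s v] with t h1 h2
  rw [h1, h2, Pi.smul_apply]

lemma dist_l2exp_sq (x : PythagoreanIntegral μ o) (v w : Lp Plane 2 μ) :
    dist (l2exp x v) (l2exp x w) ^ 2 =
      ∫ t, dist (hexp (x.1 t) (v t)) (hexp (x.1 t) (w t)) ^ 2 ∂μ := by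
  rw [PythagoreanIntegral.dist_sq]
  apply integral_congr_ae
  filter_upwards [coeFn_l2exp x v, coeFn_l2exp x w] with t h1 h2
  rw [h1, h2]

lemma l2exp_surjective (x : PythagoreanIntegral μ o) : Function.Surjective (l2exp x) := by
  intro y
  have hcoe := AEEqFun.coeFn_comp₂Measurable hlog measurable_hlog x.1 y.1
  have hmem : AEEqFun.comp₂Measurable hlog measurable_hlog x.1 y.1 ∈ Lp Plane 2 μ := by
    rw [Lp.mem_Lp_iff_memLp, memLp_two_iff_integrable_sq_norm (AEEqFun.aestronglyMeasurable _)]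
    refine (x.integrable_dist_sq y).congr ?_
    filter_upwards [hcoe] with t ht
    rw [ht, ← dist_self_hexp (x.1 t), hexp_hlog]
  refine ⟨⟨_, hmem⟩, ?_⟩
  apply Subtype.ext
  apply AEEqFun.ext
  filter_upwards [hcoe, coeFn_l2exp x ⟨_, hmem⟩] with t h1 h2
  rw [h2, h1, hexp_hlog]

lemma dist_self_l2exp_sq (x : PythagoreanIntegral μ o) (v : Lp Plane 2 μ) :
    dist x (l2exp x v) ^ 2 = ‖v‖ ^ 2 := by
  rw [PythagoreanIntegral.dist_sq, norm_sq_eq_integral]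
  apply integral_congr_ae
  filter_upwards [coeFn_l2exp x v] with t ht
  rw [ht, dist_self_hexp]

lemma norm_sub_le_dist_l2exp (x : PythagoreanIntegral μ o) (v w : Lp Plane 2 μ) :
    ‖v - w‖ ≤ dist (l2exp x v) (l2exp x w) := by
  refine (abs_le_of_sq_le_sq' ?_ dist_nonneg).2
  rw [norm_sub_sq_eq_integral, PythagoreanIntegral.dist_sq]
  refine integral_mono_of_nonneg (Eventually.of_forall fun _ => sq_nonneg _)
    (PythagoreanIntegral.integrable_dist_sq _ _) ?_
  filter_upwards [coeFn_l2exp x v, coeFn_l2exp x w] with t h1 h2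
  rw [h1, h2]
  exact pow_le_pow_left₀ (norm_nonneg _) (norm_sub_le_dist_hexp _ _ _) 2

lemma l2exp_convexity (x : PythagoreanIntegral μ o) (v : Lp Plane 2 μ)
    (z : PythagoreanIntegral μ o) (l : ℝ) (hl : 0 ≤ l) (hl1 : l ≤ 1) :
    dist (l2exp x (l • v)) z ^ 2 ≤
      (1 - l) * dist x z ^ 2 + l * dist (l2exp x v) z ^ 2 - l * (1 - l) * ‖v‖ ^ 2 := by
  rw [PythagoreanIntegral.dist_sq, PythagoreanIntegral.dist_sq, PythagoreanIntegral.dist_sq,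
    norm_sq_eq_integral, ← integral_const_mul, ← integral_const_mul, ← integral_const_mul]
  have i1 := (x.integrable_dist_sq z).const_mul (1 - l)
  have i2 := ((l2exp x v).integrable_dist_sq z).const_mul l
  have i3 := (integrable_norm_sq v).const_mul (l * (1 - l))
  have i12 : Integrable (fun t => (1 - l) * dist (x.1 t) (z.1 t) ^ 2 +
      l * dist ((l2exp x v).1 t) (z.1 t) ^ 2) μ := i1.add i2
  rw [← integral_add i1 i2, ← integral_sub i12 i3]
  refine integral_mono_ae (PythagoreanIntegral.integrable_dist_sq _ _) (i12.sub i3) ?_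
  filter_upwards [coeFn_l2exp x v, coeFn_l2exp_smul x l v] with t h1 h2
  rw [h1, h2]
  exact hexp_convexity _ _ _ l hl hl1

lemma tendsto_dist_l2exp (x : PythagoreanIntegral μ o) (v w : Lp Plane 2 μ) :
    Tendsto (fun s : ℝ => dist (l2exp x (s • v)) (l2exp x (s • w)) ^ 2 / s ^ 2) (𝓝[>] 0)
      (𝓝 (‖v - w‖ ^ 2)) := by
  rw [norm_sub_sq_eq_integral]
  have heq : ∀ s : ℝ, dist (l2exp x (s • v)) (l2exp x (s • w)) ^ 2 / s ^ 2 =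
      ∫ t, dist ((l2exp x (s • v)).1 t) ((l2exp x (s • w)).1 t) ^ 2 / s ^ 2 ∂μ := fun s => by
    rw [integral_div, PythagoreanIntegral.dist_sq]
  have heq' : ∀ s : ℝ,
      (fun t => dist ((l2exp x (s • v)).1 t) ((l2exp x (s • w)).1 t) ^ 2 / s ^ 2) =ᵐ[μ]
      fun t => dist (hexp (x.1 t) (s • v t)) (hexp (x.1 t) (s • w t)) ^ 2 / s ^ 2 := fun s => by
    filter_upwards [coeFn_l2exp_smul x s v, coeFn_l2exp_smul x s w] with t h1 h2
    rw [h1, h2]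
  simp_rw [heq]
  rw [tendsto_congr fun s => integral_congr_ae (heq' s)]
  refine tendsto_integral_filter_of_dominated_convergence
    (fun t => 2 * ‖v t‖ ^ 2 + 2 * ‖w t‖ ^ 2) ?_ ?_ ?_ ?_
  · refine Eventually.of_forall fun s => AEStronglyMeasurable.congr ?_ (heq' s)
    exact ((PythagoreanIntegral.integrable_dist_sq _ _).div_const _).1
  · filter_upwards [self_mem_nhdsWithin] with s hs
    have hs' : (0 : ℝ) < s := hs
    refine Eventually.of_forall fun t => ?_
    rw [Real.norm_of_nonneg (by positivity), div_le_iff₀ (by positivity)]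
    have h1 := dist_triangle_left (hexp (x.1 t) (s • v t)) (hexp (x.1 t) (s • w t)) (x.1 t)
    rw [dist_self_hexp, dist_self_hexp, norm_smul, norm_smul, Real.norm_of_nonneg hs'.le] at h1
    have h2 := pow_le_pow_left₀ dist_nonneg h1 2
    nlinarith [sq_nonneg (s * (‖v t‖ - ‖w t‖))]
  · exact ((integrable_norm_sq v).const_mul 2).add ((integrable_norm_sq w).const_mul 2)
  · exact Eventually.of_forall fun t => tendsto_dist_hexp _ _ _

/-- The exponential map of `L²(Ω, ℍ)` is a polar chart. -/
theorem isPolarChart_l2exp (x : PythagoreanIntegral μ o) : IsPolarChart x (l2exp x) where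
  surjective := l2exp_surjective x
  dist_center v := by
    rw [← sq_eq_sq₀ dist_nonneg (norm_nonneg _), dist_self_l2exp_sq]
  norm_sub_le := norm_sub_le_dist_l2exp x
  convexity := l2exp_convexity x
  tendsto := tendsto_dist_l2exp x

lemma dist_l2exp_neg (x : PythagoreanIntegral μ o) (v w : Lp Plane 2 μ) :
    dist (l2exp x (-v)) (l2exp x (-w)) = dist (l2exp x v) (l2exp x w) := by
  rw [← sq_eq_sq₀ dist_nonneg dist_nonneg, dist_l2exp_sq, dist_l2exp_sq]
  apply integral_congr_ae
  filter_upwards [Lp.coeFn_neg v, Lp.coeFn_neg w] with t h1 h2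
  rw [h1, h2, Pi.neg_apply, Pi.neg_apply, dist_hexp_neg]

/-- The map that is constant, equal to the base point. -/
def basePoint (μ : Measure Ω) (o : UpperHalfPlane) : PythagoreanIntegral μ o :=
  ⟨AEEqFun.const Ω o, by
    refine (integrable_zero Ω ℝ μ).congr ?_
    filter_upwards [AEEqFun.coeFn_const (μ := μ) Ω o] with t ht
    rw [ht]; simp⟩

instance completeSpace_pythagoreanIntegral : CompleteSpace (PythagoreanIntegral μ o) := by
  refine Metric.complete_of_cauchySeq_tendsto fun u hu => ?_
  -- The logarithm at the base point is 1-Lipschitz, so it maps `u` to a Cauchy sequence `v` of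
  -- `L²`, a subsequence of which converges almost everywhere.
  set x := basePoint μ o
  choose v hv using fun n => l2exp_surjective x (u n)
  have hvC : CauchySeq v := by
    rw [Metric.cauchySeq_iff] at hu ⊢
    intro ε hε
    obtain ⟨N, hN⟩ := hu ε hε
    refine ⟨N, fun m hm n hn => ?_⟩
    rw [dist_eq_norm]
    refine (norm_sub_le_dist_l2exp x _ _).trans_lt ?_
    rw [hv, hv]
    exact hN m hm n hn
  obtain ⟨w, hw⟩ := cauchySeq_tendsto_of_complete hvC
  obtain ⟨ns, hns, hae⟩ := (tendstoInMeasure_of_tendsto_Lp hw).exists_seq_tendsto_ae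
  refine ⟨l2exp x w, ?_⟩
  have hlim : ∀ᵐ t ∂μ, Tendsto (fun k => (u (ns k)).1 t) atTop (𝓝 ((l2exp x w).1 t)) := by
    filter_upwards [hae, coeFn_l2exp x w, ae_all_iff.2 fun k => coeFn_l2exp x (v k)]
      with t h1 h2 h3
    rw [h2]
    refine (((continuous_hexp (x.1 t)).tendsto _).comp h1).congr fun k => ?_
    rw [← hv, h3, Function.comp_apply]
  rw [Metric.tendsto_atTop]
  intro ε hε
  obtain ⟨N, hN⟩ := Metric.cauchySeq_iff.1 hu (ε / 2) (by positivity)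
  refine ⟨N, fun n hn => ?_⟩
  have : dist (u n) (l2exp x w) ≤ ε / 2 := by
    refine PythagoreanIntegral.dist_le_of_tendsto_ae hlim ?_
    filter_upwards [eventually_ge_atTop N] with k hk
    exact (hN n hn (ns k) (hk.trans (hns.id_le k))).le
  linarith

/-- The geodesic symmetry at `x` is `v ↦ -v` in the exponential chart. -/
theorem isCAT0Symmetric_pythagoreanIntegral : IsCAT0Symmetric (PythagoreanIntegral μ o) where
  cat0 := isCAT0_of_polarChart fun x => ⟨l2exp x, isPolarChart_l2exp x⟩
  complete := inferInstance
  symmetry x := by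
    have hx := isPolarChart_l2exp x
    let e := Equiv.ofBijective (l2exp x) ⟨hx.injective, hx.surjective⟩
    have he : ∀ y, l2exp x (e.symm y) = y := fun y => e.apply_symm_apply y
    refine ⟨IsometryEquiv.mk ((e.symm.trans (Equiv.neg _)).trans e)
      (Isometry.of_dist_eq fun y z => ?_), fun y => ?_, fun y => ?_⟩
    · change dist (l2exp x (-(e.symm y))) (l2exp x (-(e.symm z))) = dist y z
      rw [dist_l2exp_neg, he, he]
    · change e (-(e.symm (e (-(e.symm y))))) = y
      simp
    · change e (-(e.symm y)) = y ↔ y = x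
      have h0 : e 0 = x := hx.map_zero
      have h2 : ∀ w : Lp Plane 2 μ, -w = w ↔ w = 0 := fun w => by
        rw [neg_eq_iff_add_eq_zero, ← two_smul ℝ w, smul_eq_zero_iff_right two_ne_zero]
      rw [← e.eq_symm_apply, h2, ← h0, e.symm_apply_eq]

end Exp

/-! ### Spaces of directions and integral joins -/

section Join

variable {V : Type*} [NormedAddCommGroup V] [InnerProductSpace ℝ V] {Y : Type*} [MetricSpace Y]
  {o : Y} {e : V → Y}

namespace IsPolarChart

/-- The square integrable map with length `weight` and direction `point`. -/
def joinVector (h : IsPolarChart o e) (p : JoinPair μ (SpaceOfDirections o)) (τ : Ω) : V :=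
  p.weight τ • (h.unitVector (p.point τ) : V)

lemma norm_joinVector (h : IsPolarChart o e) (p : JoinPair μ (SpaceOfDirections o)) (τ : Ω) :
    ‖h.joinVector p τ‖ = p.weight τ := by
  rw [joinVector, norm_smul, h.norm_unitVector, mul_one, Real.norm_of_nonneg (p.weight_nonneg τ)]

lemma memLp_joinVector (h : IsPolarChart o e) (p : JoinPair μ (SpaceOfDirections o)) :
    MemLp (h.joinVector p) 2 μ := by
  have hm : StronglyMeasurable (h.joinVector p) := p.weight_meas.stronglyMeasurable.smul
    ((continuous_subtype_val.comp h.continuous_unitVector).comp_stronglyMeasurable p.point_meas)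
  rw [memLp_two_iff_integrable_sq_norm hm.aestronglyMeasurable]
  simp_rw [h.norm_joinVector]
  exact p.weight_sq_integrable

/-- The pairing of the integral join is the inner product of `L²`. -/
lemma inner_joinVector (h : IsPolarChart o e) (p q : JoinPair μ (SpaceOfDirections o)) :
    inner ℝ ((h.memLp_joinVector p).toLp) ((h.memLp_joinVector q).toLp) =
      JoinPair.pairing p q := by
  rw [L2.inner_def, JoinPair.pairing]
  apply integral_congr_ae
  filter_upwards [(h.memLp_joinVector p).coeFn_toLp, (h.memLp_joinVector q).coeFn_toLp]
    with τ h1 h2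
  rw [h1, h2, joinVector, joinVector, real_inner_smul_left, real_inner_smul_right,
    h.inner_unitVector]
  ring

lemma norm_toLp_joinVector (h : IsPolarChart o e) (p : JoinPair μ (SpaceOfDirections o)) :
    ‖(h.memLp_joinVector p).toLp‖ = 1 := by
  rw [← sq_eq_sq₀ (norm_nonneg _) zero_le_one, norm_sq_eq_integral, one_pow, ← p.weight_integral]
  apply integral_congr_ae
  filter_upwards [(h.memLp_joinVector p).coeFn_toLp] with τ h1
  rw [h1, h.norm_joinVector]

/-- A unit vector of `L²` splits into its pointwise norm and its pointwise direction; where it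
vanishes, the direction is an arbitrary constant. -/
lemma exists_joinVector_eq [MeasurableSpace V] [BorelSpace V] [SecondCountableTopology V]
    [Nontrivial V] (h : IsPolarChart o e) (v : Lp V 2 μ) (hv : ‖v‖ = 1) :
    ∃ p : JoinPair μ (SpaceOfDirections o), (h.memLp_joinVector p).toLp = v := by
  classical
  obtain ⟨u, hu⟩ := exists_norm_eq V zero_le_one
  have hN : ∀ w : V, (if w = 0 then u else ‖w‖⁻¹ • w) ∈ Metric.sphere (0 : V) 1 := by
    intro w
    rw [mem_sphere_zero_iff_norm]
    split_ifs with hw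
    · exact hu
    · rw [norm_smul, norm_inv, norm_norm, inv_mul_cancel₀ (norm_ne_zero_iff.2 hw)]
  have hNm : Measurable fun w : V => (⟨_, hN w⟩ : Metric.sphere (0 : V) 1) := by
    refine Measurable.subtype_mk (Measurable.ite (measurableSet_singleton 0) measurable_const ?_)
    exact measurable_norm.inv.smul measurable_id
  have hvm : StronglyMeasurable v := Lp.stronglyMeasurable v
  refine ⟨⟨fun τ => h.direction ⟨_, hN (v τ)⟩, fun τ => ‖v τ‖, ?_, ?_, fun τ => norm_nonneg _, ?_⟩,
    ?_⟩
  · exact h.continuous_direction.comp_stronglyMeasurable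
      (hNm.comp hvm.measurable).stronglyMeasurable
  · exact hvm.norm.measurable
  · rw [← norm_sq_eq_integral, hv, one_pow]
  · apply Lp.ext
    refine (MemLp.coeFn_toLp _).trans (Eventually.of_forall fun τ => ?_)
    simp only [joinVector, h.unitVector_direction]
    split_ifs with hw
    · rw [hw]; simp
    · rw [smul_smul, mul_inv_cancel₀ (norm_ne_zero_iff.2 hw), one_smul]

/-- If the space of directions at `o` is the unit sphere of `V` and the one at `x` is the unit
sphere of `L²(Ω, V)`, then the latter is the integral join of the former. -/
theorem nonempty_direction_equiv_join [MeasurableSpace V] [BorelSpace V]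
    [SecondCountableTopology V] [Nontrivial V] (h : IsPolarChart o e) {X : Type*} [MetricSpace X]
    {x : X} {E : Lp V 2 μ → X} (H : IsPolarChart x E) :
    Nonempty (SpaceOfDirections x ≃ᵢ IntegralJoin μ (SpaceOfDirections o)) := by
  let J : JoinPair μ (SpaceOfDirections o) → SpaceOfDirections x := fun p =>
    H.direction ⟨(h.memLp_joinVector p).toLp, by
      rw [mem_sphere_zero_iff_norm]; exact h.norm_toLp_joinVector p⟩
  have hJ : ∀ p q, dist (J p) (J q) = dist p q := by
    intro p q
    have : InnerProductGeometry.angle (h.memLp_joinVector p).toLp (h.memLp_joinVector q).toLp =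
        Real.arccos (JoinPair.pairing p q) := by
      rw [InnerProductGeometry.angle, h.norm_toLp_joinVector, h.norm_toLp_joinVector,
        h.inner_joinVector, mul_one, div_one]
    exact (H.dist_direction _ _).trans this
  let J' : IntegralJoin μ (SpaceOfDirections o) → SpaceOfDirections x :=
    SeparationQuotient.lift J fun p q hpq => by
      rw [← dist_eq_zero, hJ]
      exact Metric.inseparable_iff.1 hpq
  have hJ' : Isometry J' := by
    apply Isometry.of_dist_eq
    intro p q
    obtain ⟨p, rfl⟩ := SeparationQuotient.surjective_mk p
    obtain ⟨q, rfl⟩ := SeparationQuotient.surjective_mk q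
    exact hJ p q
  have hsurj : Function.Surjective J' := by
    intro y
    obtain ⟨v, rfl⟩ := H.direction_surjective y
    obtain ⟨p, hp⟩ := h.exists_joinVector_eq v.1 (mem_sphere_zero_iff_norm.1 v.2)
    refine ⟨SeparationQuotient.mk p, ?_⟩
    change J p = _
    exact congrArg H.direction (Subtype.ext hp)
  exact ⟨(IsometryEquiv.mk (Equiv.ofBijective J' ⟨hJ'.injective, hsurj⟩) hJ').symm⟩

end IsPolarChart

end Join

end Integral

/-! ### Riemannian manifolds are locally almost isometric to Hilbert spaces -/

section Manifold

lemma enorm_map_sub_le_lintegral {E F : Type*} [NormedAddCommGroup E] [NormedSpace ℝ E]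
    [NormedAddCommGroup F] [NormedSpace ℝ F] (L : E →L[ℝ] F) {f : ℝ → E} {a b : ℝ} (hab : a < b)
    (hf : ContDiffOn ℝ 1 f (Set.Icc a b)) :
    ‖L (f b) - L (f a)‖ₑ ≤ ∫⁻ t in Set.Icc a b, ‖L (derivWithin f (Set.Icc a b) t)‖ₑ := by
  refine (enorm_sub_le_lintegral_derivWithin_Icc_of_contDiffOn_Icc
    (L.contDiff.comp_contDiffOn hf) hab.le).trans_eq ?_
  refine setLIntegral_congr_fun measurableSet_Icc fun t ht => ?_
  have h1 : HasDerivWithinAt f (derivWithin f (Set.Icc a b) t) (Set.Icc a b) t :=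
    (hf.differentiableOn one_ne_zero t ht).hasDerivWithinAt
  have h2 := L.hasFDerivAt.comp_hasDerivWithinAt t h1
  rw [h2.derivWithin (uniqueDiffOn_Icc hab t ht)]

variable {E : Type*} [NormedAddCommGroup E] [InnerProductSpace ℝ E]
  {M : Type*} [EMetricSpace M] [ChartedSpace E M] [IsManifold 𝓘(ℝ, E) 1 M]
  [Bundle.RiemannianBundle (fun x : M => TangentSpace 𝓘(ℝ, E) x)]

/-- The chart at `x`, with values in the tangent space at `x`, which carries the Riemannian norm. -/
def tangentChart (x y : M) : TangentSpace 𝓘(ℝ, E) x :=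
  (trivializationAt E (fun x : M => TangentSpace 𝓘(ℝ, E) x) x).symmL ℝ x (extChartAt 𝓘(ℝ, E) x y)

/-- If the differential of the chart at `x` has norm at most `r` along a path, then the image of
the path in the chart is at most `r` times as long. -/
lemma enorm_tangentChart_sub_le (x : M) {r : ℝ≥0} {γ : ℝ → M}
    (hγ : ContMDiffOn 𝓘(ℝ, ℝ) 𝓘(ℝ, E) 1 γ (Set.Icc 0 1))
    (hsource : ∀ t ∈ Set.Icc (0 : ℝ) 1, γ t ∈ (chartAt E x).source)
    (hr : ∀ t ∈ Set.Icc (0 : ℝ) 1,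
      ‖((trivializationAt E (fun x : M => TangentSpace 𝓘(ℝ, E) x) x).symmL ℝ x)
      ∘L ((trivializationAt E (fun x : M => TangentSpace 𝓘(ℝ, E) x) x).continuousLinearMapAt ℝ
        (γ t))‖ ≤ r) :
    ‖tangentChart (E := E) x (γ 1) - tangentChart (E := E) x (γ 0)‖ₑ ≤
      r * Manifold.pathELength 𝓘(ℝ, E) γ 0 1 := by
  have hC : ContMDiffOn 𝓘(ℝ, ℝ) 𝓘(ℝ, E) 1 (extChartAt 𝓘(ℝ, E) x ∘ γ) (Set.Icc 0 1) :=
    contMDiffOn_extChartAt.comp (I' := 𝓘(ℝ, E)) (t := (chartAt E x).source) hγ hsource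
  refine (enorm_map_sub_le_lintegral
    ((trivializationAt E (fun x : M => TangentSpace 𝓘(ℝ, E) x) x).symmL ℝ x) zero_lt_one
    (contMDiffOn_iff_contDiffOn.1 hC)).trans ?_
  rw [Manifold.pathELength_eq_lintegral_mfderivWithin_Icc,
    ← lintegral_const_mul' _ _ ENNReal.coe_ne_top]
  refine setLIntegral_mono' measurableSet_Icc fun t ht => ?_
  have h1 : mfderivWithin 𝓘(ℝ, ℝ) 𝓘(ℝ, E) (extChartAt 𝓘(ℝ, E) x ∘ γ) (Set.Icc 0 1) t =
      (mfderiv 𝓘(ℝ, E) 𝓘(ℝ, E) (extChartAt 𝓘(ℝ, E) x) (γ t)) ∘L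
        (mfderivWithin 𝓘(ℝ, ℝ) 𝓘(ℝ, E) γ (Set.Icc 0 1) t) := by
    apply mfderiv_comp_mfderivWithin
    · exact mdifferentiableAt_extChartAt (hsource t ht)
    · exact hγ.mdifferentiableOn one_ne_zero t ht
    · rw [uniqueMDiffWithinAt_iff_uniqueDiffWithinAt]
      exact uniqueDiffOn_Icc zero_lt_one t ht
  have h2 : derivWithin (extChartAt 𝓘(ℝ, E) x ∘ γ) (Set.Icc 0 1) t =
      (trivializationAt E (fun x : M => TangentSpace 𝓘(ℝ, E) x) x).continuousLinearMapAt ℝ (γ t)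
        (mfderivWithin 𝓘(ℝ, ℝ) 𝓘(ℝ, E) γ (Set.Icc 0 1) t 1) := by
    rw [TangentBundle.continuousLinearMapAt_trivializationAt (hsource t ht),
      ← fderivWithin_derivWithin, ← mfderivWithin_eq_fderivWithin]
    exact congr($h1 1)
  rw [h2]
  have h3 := ContinuousLinearMap.le_opENorm
    (((trivializationAt E (fun x : M => TangentSpace 𝓘(ℝ, E) x) x).symmL ℝ x)
      ∘L ((trivializationAt E (fun x : M => TangentSpace 𝓘(ℝ, E) x) x).continuousLinearMapAt ℝ
        (γ t))) (mfderivWithin 𝓘(ℝ, ℝ) 𝓘(ℝ, E) γ (Set.Icc 0 1) t 1)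
  refine h3.trans ?_
  gcongr
  rw [← ofReal_norm, ← ENNReal.ofReal_coe_nnreal]
  exact ENNReal.ofReal_le_ofReal (hr t ht)

variable [IsContinuousRiemannianBundle E (fun x : M => TangentSpace 𝓘(ℝ, E) x)]
  [IsRiemannianManifold 𝓘(ℝ, E) M]

lemma exists_nhds_enorm_tangentChart_sub_le (x : M) {r : ℝ≥0} (hr : 1 < r) :
    ∃ U ∈ 𝓝 x, ∀ p ∈ U, ∀ q ∈ U,
      ‖tangentChart (E := E) x p - tangentChart (E := E) x q‖ₑ ≤ r * edist p q := by
  have hG := (eventually_norm_symmL_trivializationAt_self_comp_lt E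
    (fun x : M => TangentSpace 𝓘(ℝ, E) x) x (r := r) (by exact_mod_cast hr)).and
    (chart_source_mem_nhds E x)
  obtain ⟨c, hc, hball⟩ := EMetric.mem_nhds_iff.1 hG
  refine ⟨Metric.eball x (c / 3), Metric.eball_mem_nhds _ (by simpa using hc.ne'), ?_⟩
  intro p hp q hq
  rw [Metric.mem_eball] at hp hq
  have hpq : edist p q < c / 3 + c / 3 := by
    refine (edist_triangle_right p q x).trans_lt (ENNReal.add_lt_add hp hq)
  have hr0 : (r : ENNReal) ≠ 0 := by
    have : r ≠ 0 := (zero_lt_one.trans hr).ne'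
    exact_mod_cast this
  rw [mul_comm, ← ENNReal.div_le_iff_le_mul (Or.inl hr0) (Or.inl ENNReal.coe_ne_top)]
  refine le_of_forall_gt_imp_ge_of_dense fun d hd => ?_
  -- A path from `q` to `p` of length close to `edist p q` does not leave the good neighbourhood.
  have hlt : Manifold.riemannianEDist 𝓘(ℝ, E) q p < min d (c / 3 + c / 3) := by
    rw [← IsRiemannianManifold.out (I := 𝓘(ℝ, E)) q p, edist_comm]
    exact lt_min hd hpq
  obtain ⟨γ, h0, h1, hγ, hlen⟩ := Manifold.exists_lt_of_riemannianEDist_lt hlt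
  have hmem : ∀ t ∈ Set.Icc (0 : ℝ) 1, γ t ∈ Metric.eball x c := by
    intro t ht
    have h2 : edist q (γ t) < c / 3 + c / 3 := by
      rw [IsRiemannianManifold.out (I := 𝓘(ℝ, E)) q (γ t)]
      refine (Manifold.riemannianEDist_le_pathELength
        (hγ.mono (Set.Icc_subset_Icc_right ht.2)) h0 rfl ht.1).trans_lt ?_
      exact (Manifold.pathELength_mono le_rfl ht.2).trans_lt (hlen.trans_le (min_le_right _ _))
    rw [Metric.mem_eball]
    calc edist (γ t) x ≤ edist q (γ t) + edist q x := edist_triangle_left _ _ _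
      _ < (c / 3 + c / 3) + c / 3 := ENNReal.add_lt_add h2 hq
      _ = c := ENNReal.add_thirds c
  have h3 := enorm_tangentChart_sub_le x hγ (r := r) (fun t ht => (hball (hmem t ht)).2)
    (fun t ht => (hball (hmem t ht)).1.le)
  rw [h0, h1] at h3
  rw [ENNReal.div_le_iff_le_mul (Or.inl hr0) (Or.inl ENNReal.coe_ne_top), mul_comm]
  refine h3.trans ?_
  gcongr
  exact hlen.le.trans (min_le_left _ _)

lemma exists_nhds_edist_le_enorm_tangentChart (x : M) {r : ℝ≥0} (hr : 1 < r) :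
    ∃ U ∈ 𝓝 x, ∀ p ∈ U, ∀ q ∈ U,
      edist p q ≤ r * ‖tangentChart (E := E) x p - tangentChart (E := E) x q‖ₑ := by
  have hG := (eventually_norm_symmL_trivializationAt_comp_self_lt E
    (fun x : M => TangentSpace 𝓘(ℝ, E) x) x (r := r) (by exact_mod_cast hr))
  have hcont : Tendsto (extChartAt 𝓘(ℝ, E) x).symm (𝓝 (extChartAt 𝓘(ℝ, E) x x)) (𝓝 x) := by
    have := (continuousAt_extChartAt_symm (I := 𝓘(ℝ, E)) x).tendsto
    rwa [extChartAt_to_inv] at this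
  obtain ⟨c, hc, hball⟩ := Metric.mem_nhds_iff.1
    ((hcont.eventually hG).and (extChartAt_target_mem_nhds (I := 𝓘(ℝ, E)) x))
  refine ⟨(extChartAt 𝓘(ℝ, E) x) ⁻¹' Metric.ball (extChartAt 𝓘(ℝ, E) x x) c ∩ (chartAt E x).source,
    inter_mem ((continuousAt_extChartAt x).preimage_mem_nhds (Metric.ball_mem_nhds _ hc))
      (chart_source_mem_nhds E x), ?_⟩
  rintro p ⟨hp, hps⟩ q ⟨hq, hqs⟩
  set a := extChartAt 𝓘(ℝ, E) x p with ha
  set b := extChartAt 𝓘(ℝ, E) x q with hb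
  let η := ContinuousAffineMap.lineMap (R := ℝ) a b
  have hη : ∀ t ∈ Set.Icc (0 : ℝ) 1, η t ∈ Metric.ball (extChartAt 𝓘(ℝ, E) x x) c := by
    intro t ht
    apply (convex_ball _ _).segment_subset hp hq
    rw [segment_eq_image_lineMap]
    exact ⟨t, ht, rfl⟩
  have η_smooth : ContMDiffOn 𝓘(ℝ, ℝ) 𝓘(ℝ, E) 1 η (Set.Icc 0 1) := by
    apply ContMDiff.contMDiffOn
    rw [contMDiff_iff_contDiff]
    exact ContinuousAffineMap.contDiff _
  have hsub : Set.Icc (0 : ℝ) 1 ⊆ η ⁻¹' (extChartAt 𝓘(ℝ, E) x).target :=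
    fun t ht => (hball (hη t ht)).2
  rw [IsRiemannianManifold.out (I := 𝓘(ℝ, E)) p q]
  have hlen : Manifold.riemannianEDist 𝓘(ℝ, E) p q ≤
      Manifold.pathELength 𝓘(ℝ, E) ((extChartAt 𝓘(ℝ, E) x).symm ∘ η) 0 1 := by
    apply Manifold.riemannianEDist_le_pathELength _ _ _ zero_le_one
    · exact (contMDiffOn_extChartAt_symm x).comp η_smooth hsub
    · simp [η, ContinuousAffineMap.coe_lineMap_eq, ha, hps]
    · simp [η, ContinuousAffineMap.coe_lineMap_eq, hb, hqs]
  refine hlen.trans ?_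
  have hconst : (r : ENNReal) * ‖tangentChart (E := E) x p - tangentChart (E := E) x q‖ₑ =
      ∫⁻ _ in Set.Icc (0 : ℝ) 1,
        r * ‖tangentChart (E := E) x p - tangentChart (E := E) x q‖ₑ := by simp
  rw [Manifold.pathELength_eq_lintegral_mfderivWithin_Icc, hconst]
  refine setLIntegral_mono' measurableSet_Icc fun t ht => ?_
  have h1 : mfderivWithin 𝓘(ℝ, ℝ) 𝓘(ℝ, E) ((extChartAt 𝓘(ℝ, E) x).symm ∘ η) (Set.Icc 0 1) t =
      (mfderivWithin 𝓘(ℝ, E) 𝓘(ℝ, E) (extChartAt 𝓘(ℝ, E) x).symm (Set.range 𝓘(ℝ, E)) (η t)) ∘L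
        (mfderivWithin 𝓘(ℝ, ℝ) 𝓘(ℝ, E) η (Set.Icc 0 1) t) := by
    apply mfderivWithin_comp
    · exact mdifferentiableWithinAt_extChartAt_symm (hsub ht)
    · exact η_smooth.mdifferentiableOn one_ne_zero t ht
    · exact hsub.trans (Set.preimage_mono (extChartAt_target_subset_range x))
    · rw [uniqueMDiffWithinAt_iff_uniqueDiffWithinAt]
      exact uniqueDiffOn_Icc zero_lt_one t ht
  have hy := (hball (hη t ht)).1
  have hys : (extChartAt 𝓘(ℝ, E) x).symm (η t) ∈ (chartAt E x).source := by
    have := (extChartAt 𝓘(ℝ, E) x).map_target (hsub ht)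
    rwa [extChartAt_source] at this
  have h2 : mfderivWithin 𝓘(ℝ, ℝ) 𝓘(ℝ, E) ((extChartAt 𝓘(ℝ, E) x).symm ∘ η) (Set.Icc 0 1) t 1 =
      (trivializationAt E (fun x : M => TangentSpace 𝓘(ℝ, E) x) x).symmL ℝ
        ((extChartAt 𝓘(ℝ, E) x).symm (η t)) (b - a) := by
    have hη' : mfderivWithin 𝓘(ℝ, ℝ) 𝓘(ℝ, E) η (Set.Icc 0 1) t 1 = b - a := by
      rw [mfderivWithin_eq_fderivWithin,
        fderivWithin_eq_fderiv (uniqueDiffOn_Icc zero_lt_one _ ht) η.differentiableAt]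
      have : HasDerivAt η (b - a) t := AffineMap.hasDerivAt_lineMap
      exact this.deriv
    rw [TangentBundle.symmL_trivializationAt hys, (extChartAt 𝓘(ℝ, E) x).right_inv (hsub ht),
      ← hη']
    exact congr($h1 1)
  have h3 : (trivializationAt E (fun x : M => TangentSpace 𝓘(ℝ, E) x) x).continuousLinearMapAt ℝ x
      (tangentChart (E := E) x q - tangentChart (E := E) x p) = b - a := by
    rw [tangentChart, tangentChart, ← map_sub]
    exact Bundle.Trivialization.continuousLinearMapAt_symmL _
      (FiberBundle.mem_baseSet_trivializationAt' x) _
  rw [h2, ← h3, enorm_sub_rev]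
  refine (ContinuousLinearMap.le_opENorm
    (((trivializationAt E (fun x : M => TangentSpace 𝓘(ℝ, E) x) x).symmL ℝ
        ((extChartAt 𝓘(ℝ, E) x).symm (η t))) ∘L
        ((trivializationAt E (fun x : M => TangentSpace 𝓘(ℝ, E) x) x).continuousLinearMapAt ℝ x))
      _).trans ?_
  gcongr
  rw [← ofReal_norm, ← ENNReal.ofReal_coe_nnreal]
  exact ENNReal.ofReal_le_ofReal hy.le

end Manifold

/-- Four points `m`, `a`, `b`, `c` of a Euclidean space with `m` almost in the middle between `a`
and `b`, all of the distances being known up to the factor `r`. -/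
lemma four_point_inequality {F : Type*} [NormedAddCommGroup F] [InnerProductSpace ℝ F]
    {a b c : F} {k r D : ℝ} (hk : 0 < k) (hr : 0 < r) (hD : 0 ≤ D)
    (ha : ‖a‖ ≤ r * k) (hb : ‖b‖ ≤ r * k) (hc : ‖c‖ ≤ r * k) (hab : 2 * k ≤ r * ‖a - b‖)
    (hac : D * k ≤ r * ‖a - c‖) (hbc : D * k ≤ r * ‖b - c‖) :
    D ^ 2 / r ^ 2 ≤ 2 * r ^ 2 + 2 * r * √(r ^ 2 - 1 / r ^ 2) := by
  have key : ∀ {A n : ℝ}, 0 ≤ A → A * k ≤ r * n → A ^ 2 / r ^ 2 * k ^ 2 ≤ n ^ 2 := by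
    intro A n hA h
    have := pow_le_pow_left₀ (by positivity) h 2
    rw [div_mul_eq_mul_div, div_le_iff₀ (by positivity)]
    nlinarith
  have hab' := key zero_le_two hab
  have hac' := key hD hac
  have hbc' := key hD hbc
  have ha' := pow_le_pow_left₀ (norm_nonneg _) ha 2
  have hb' := pow_le_pow_left₀ (norm_nonneg _) hb 2
  have hc' := pow_le_pow_left₀ (norm_nonneg _) hc 2
  have hsum : ‖a + b‖ ≤ 2 * k * √(r ^ 2 - 1 / r ^ 2) := by
    have h1 : ‖a + b‖ ^ 2 ≤ (2 * k) ^ 2 * (r ^ 2 - 1 / r ^ 2) := by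
      have h2 := parallelogram_law_with_norm ℝ a b
      have h3 : (2 : ℝ) ^ 2 / r ^ 2 * k ^ 2 = (2 * k) ^ 2 * (1 / r ^ 2) := by ring
      nlinarith
    have h4 := Real.abs_le_sqrt h1
    rwa [abs_of_nonneg (norm_nonneg _), Real.sqrt_mul (by positivity),
      Real.sqrt_sq (by positivity)] at h4
  have hinner := abs_real_inner_le_norm (a + b) c
  have hprod : ‖a + b‖ * ‖c‖ ≤ 2 * k * √(r ^ 2 - 1 / r ^ 2) * (r * k) :=
    mul_le_mul hsum hc (norm_nonneg _) (by positivity)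
  have hlow := neg_abs_le (inner ℝ (a + b) c)
  rw [norm_sub_sq_real] at hac' hbc'
  rw [inner_add_left] at hlow hinner
  have hfin : (2 * k ^ 2) * (D ^ 2 / r ^ 2) ≤
      (2 * k ^ 2) * (2 * r ^ 2 + 2 * r * √(r ^ 2 - 1 / r ^ 2)) := by
    nlinarith
  exact le_of_mul_le_mul_left hfin (by positivity)

/-- A metric space that contains, near a point `m` and at all small scales `k`, points `a`, `b`, `c`
at distance `k` from `m` with `d(a, b) = 2 k` and `d(a, c), d(b, c) ≥ D k`, `D > √2`, is not
isometric to a Riemannian manifold. -/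
theorem isEmpty_isometryEquiv_of_four_points (E : Type*) [NormedAddCommGroup E]
    [InnerProductSpace ℝ E] {M : Type*} [EMetricSpace M] [ChartedSpace E M]
    [IsManifold 𝓘(ℝ, E) 1 M] [Bundle.RiemannianBundle (fun x : M => TangentSpace 𝓘(ℝ, E) x)]
    [IsContinuousRiemannianBundle E (fun x : M => TangentSpace 𝓘(ℝ, E) x)]
    [IsRiemannianManifold 𝓘(ℝ, E) M] {X : Type*} [MetricSpace X] {m : X} {D : ℝ}
    (hD0 : 0 ≤ D) (hD : 2 < D ^ 2)
    (H : ∀ k : ℝ, 0 < k → k ≤ 1 → ∃ a b c : X, dist a m = k ∧ dist b m = k ∧ dist c m = k ∧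
      2 * k ≤ dist a b ∧ D * k ≤ dist a c ∧ D * k ≤ dist b c) : IsEmpty (X ≃ᵢ M) := by
  refine ⟨fun T => ?_⟩
  have key : ∀ r : ℝ, 1 < r → 0 ≤ 2 * r ^ 2 + 2 * r * √(r ^ 2 - 1 / r ^ 2) - D ^ 2 / r ^ 2 := by
    intro r hr
    lift r to ℝ≥0 using by linarith
    have hr' : 1 < r := by exact_mod_cast hr
    obtain ⟨U, hU, hU'⟩ := exists_nhds_enorm_tangentChart_sub_le (E := E) (T m) hr'
    obtain ⟨W, hW, hW'⟩ := exists_nhds_edist_le_enorm_tangentChart (E := E) (T m) hr'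
    have hpre : T ⁻¹' (U ∩ W) ∈ 𝓝 m := T.continuous.continuousAt.preimage_mem_nhds (inter_mem hU hW)
    obtain ⟨e, he, hball⟩ := Metric.mem_nhds_iff.1 hpre
    have hk : 0 < min (e / 2) 1 := lt_min (by positivity) one_pos
    obtain ⟨a, b, c, ha, hb, hc, hab, hac, hbc⟩ := H _ hk (min_le_right _ _)
    set k := min (e / 2) 1 with hkdef
    have hke : k < e := (min_le_left _ _).trans_lt (by linarith)
    have mm := hball (Metric.mem_ball_self he)
    have ma := hball (show a ∈ Metric.ball m e by rwa [Metric.mem_ball, ha])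
    have mb := hball (show b ∈ Metric.ball m e by rwa [Metric.mem_ball, hb])
    have mc := hball (show c ∈ Metric.ball m e by rwa [Metric.mem_ball, hc])
    let f : X → TangentSpace 𝓘(ℝ, E) (T m) := fun y => tangentChart (E := E) (T m) (T y)
    have up : ∀ y z, T y ∈ U ∩ W → T z ∈ U ∩ W → ‖f y - f z‖ ≤ r * dist y z := by
      intro y z hy hz
      have h1 := hU' _ hy.1 _ hz.1
      rw [T.isometry.edist_eq, edist_dist, ← ofReal_norm, ← ENNReal.ofReal_coe_nnreal,
        ← ENNReal.ofReal_mul r.coe_nonneg] at h1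
      exact (ENNReal.ofReal_le_ofReal_iff (by positivity)).1 h1
    have low : ∀ y z, T y ∈ U ∩ W → T z ∈ U ∩ W → dist y z ≤ r * ‖f y - f z‖ := by
      intro y z hy hz
      have h1 := hW' _ hy.2 _ hz.2
      rw [T.isometry.edist_eq, edist_dist, ← ofReal_norm, ← ENNReal.ofReal_coe_nnreal,
        ← ENNReal.ofReal_mul r.coe_nonneg] at h1
      exact (ENNReal.ofReal_le_ofReal_iff (by positivity)).1 h1
    have := four_point_inequality (a := f a - f m) (b := f b - f m) (c := f c - f m) hk
      (zero_lt_one.trans hr) hD0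
      (by rw [← ha]; exact up a m ma mm) (by rw [← hb]; exact up b m mb mm)
      (by rw [← hc]; exact up c m mc mm)
      (by rw [sub_sub_sub_cancel_right]; exact hab.trans (low a b ma mb))
      (by rw [sub_sub_sub_cancel_right]; exact hac.trans (low a c ma mc))
      (by rw [sub_sub_sub_cancel_right]; exact hbc.trans (low b c mb mc))
    linarith
  have hlim : Tendsto (fun r : ℝ => 2 * r ^ 2 + 2 * r * √(r ^ 2 - 1 / r ^ 2) - D ^ 2 / r ^ 2)
      (𝓝[>] 1) (𝓝 (2 - D ^ 2)) := by
    have hc : ContinuousAt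
        (fun r : ℝ => 2 * r ^ 2 + 2 * r * √(r ^ 2 - 1 / r ^ 2) - D ^ 2 / r ^ 2) 1 := by
      have h1 : ContinuousAt (fun r : ℝ => 1 / r ^ 2) 1 :=
        continuousAt_const.div (by fun_prop) (by norm_num)
      have h2 : ContinuousAt (fun r : ℝ => D ^ 2 / r ^ 2) 1 :=
        continuousAt_const.div (by fun_prop) (by norm_num)
      exact ((by fun_prop : ContinuousAt (fun r : ℝ => 2 * r ^ 2) 1).add
        ((by fun_prop : ContinuousAt (fun r : ℝ => 2 * r) 1).mul
          ((by fun_prop : ContinuousAt (fun r : ℝ => r ^ 2) 1).sub h1).sqrt)).sub h2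
    have h3 := hc.tendsto
    rw [show (2 * (1 : ℝ) ^ 2 + 2 * 1 * √(1 ^ 2 - 1 / 1 ^ 2) - D ^ 2 / 1 ^ 2) = 2 - D ^ 2 by
      norm_num] at h3
    exact h3.mono_left nhdsWithin_le_nhds
  have := ge_of_tendsto hlim (b := 0) (by
    filter_upwards [self_mem_nhdsWithin] with r hr
    exact key r hr)
  linarith

/-! ### Small scaled copies of the hyperbolic plane -/

/-- Maps that are constant on a set of measure `k²` and equal to `o` on the complement form a copy
of the hyperbolic plane scaled by the factor `k`, that is, of curvature `-1 / k²`. -/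
lemma exists_scaled_copy (o : UpperHalfPlane) {k : ℝ} (hk : 0 ≤ k) (hk1 : k ≤ 1) :
    ∃ f : UpperHalfPlane → L2H o, f o = basePoint volume o ∧
      ∀ a b, dist (f a) (f b) = k * dist a b := by
  classical
  have hmem : k ^ 2 ∈ unitInterval := ⟨sq_nonneg _, pow_le_one₀ hk hk1⟩
  let A : Set unitInterval := Set.Iic ⟨k ^ 2, hmem⟩
  have hA : MeasurableSet A := measurableSet_Iic
  have hvol : (volume : Measure unitInterval).real A = k ^ 2 := by
    rw [measureReal_def, unitInterval.volume_Iic, ENNReal.toReal_ofReal (sq_nonneg _)]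
  have hsm : ∀ a : UpperHalfPlane, AEStronglyMeasurable
      (fun t : unitInterval => if t ∈ A then a else o) volume := fun a =>
    (Measurable.ite hA measurable_const measurable_const).aestronglyMeasurable
  have hdist : ∀ a b : UpperHalfPlane,
      (fun t : unitInterval => dist (if t ∈ A then a else o) (if t ∈ A then b else o) ^ 2) =
      A.indicator fun _ => dist a b ^ 2 := by
    intro a b
    funext t
    by_cases ht : t ∈ A <;> simp [ht]
  have hint : ∀ a : UpperHalfPlane, Integrable (fun t =>
      dist o ((AEEqFun.mk _ (hsm a) : unitInterval →ₘ[volume] UpperHalfPlane) t) ^ 2) volume := by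
    intro a
    refine Integrable.congr ((integrable_const (dist o a ^ 2)).indicator hA) ?_
    filter_upwards [AEEqFun.coeFn_mk _ (hsm a)] with t ht
    rw [ht, ← hdist o a]
    simp only [ite_self]
  let f : UpperHalfPlane → L2H o := fun a => ⟨AEEqFun.mk _ (hsm a), hint a⟩
  have hf : ∀ a b, dist (f a) (f b) ^ 2 = ∫ t, dist ((f a).1 t) ((f b).1 t) ^ 2 := fun a b =>
    PythagoreanIntegral.dist_sq _ _
  refine ⟨f, ?_, fun a b => ?_⟩
  · apply Subtype.ext
    apply AEEqFun.ext
    filter_upwards [AEEqFun.coeFn_mk _ (hsm o),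
      AEEqFun.coeFn_const (μ := (volume : Measure unitInterval)) unitInterval o] with t h1 h2
    rw [h1]
    refine Eq.trans ?_ h2.symm
    simp
  · rw [← sq_eq_sq₀ dist_nonneg (by positivity), hf, mul_pow, ← hvol]
    have : ∫ t, (A.indicator fun _ => dist a b ^ 2) t ∂(volume : Measure unitInterval) =
        (volume : Measure unitInterval).real A * dist a b ^ 2 := by
      rw [integral_indicator_const _ hA, smul_eq_mul]
    rw [← this, ← hdist a b]
    apply integral_congr_ae
    filter_upwards [AEEqFun.coeFn_mk _ (hsm a), AEEqFun.coeFn_mk _ (hsm b)] with t h1 h2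
    change dist ((AEEqFun.mk _ (hsm a) : unitInterval →ₘ[volume] UpperHalfPlane) t)
      ((AEEqFun.mk _ (hsm b) : unitInterval →ₘ[volume] UpperHalfPlane) t) ^ 2 = _
    rw [h1, h2]

/-! ### A right-angled hyperbolic triangle -/

lemma exists_orthonormal_plane : ∃ u v : Plane, ‖u‖ = 1 ∧ ‖v‖ = 1 ∧ inner ℝ u v = 0 :=
  ⟨EuclideanSpace.single 0 1, EuclideanSpace.single 1 1, by simp, by simp, by
    rw [plane_inner]; simp⟩

lemma cosh_dist_hexp_of_inner_eq_zero (p : UpperHalfPlane) {u v : Plane} (h : inner ℝ u v = 0) :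
    Real.cosh (dist (hexp p u) (hexp p v)) = Real.cosh ‖u‖ * Real.cosh ‖v‖ := by
  rw [cosh_dist_hexp, InnerProductGeometry.cos_angle, h]
  simp

/-- Halving the legs of a hyperbolic isosceles right-angled triangle makes the hypotenuse less than
half as long. -/
lemma two_mul_dist_hexp_half_lt (p : UpperHalfPlane) {u v : Plane} (hu : ‖u‖ = 1) (hv : ‖v‖ = 1)
    (h : inner ℝ u v = 0) : 2 * dist (hexp p ((1 / 2 : ℝ) • u)) (hexp p ((1 / 2 : ℝ) • v)) <
      dist (hexp p u) (hexp p v) := by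
  have h1 := cosh_dist_hexp_of_inner_eq_zero p h
  have h2 := cosh_dist_hexp_of_inner_eq_zero p (u := (1 / 2 : ℝ) • u) (v := (1 / 2 : ℝ) • v)
    (by rw [real_inner_smul_left, real_inner_smul_right, h]; simp)
  rw [hu, hv] at h1
  rw [norm_smul, norm_smul, hu, hv, Real.norm_of_nonneg (by norm_num), mul_one] at h2
  set d := dist (hexp p ((1 / 2 : ℝ) • u)) (hexp p ((1 / 2 : ℝ) • v))
  -- With `c = cosh² (1 / 2)` this is the inequality `2 c² - 1 < (2 c - 1)²`, where `c > 1`.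
  have h3 : Real.cosh (2 * d) < Real.cosh (dist (hexp p u) (hexp p v)) := by
    have e1 := Real.cosh_two_mul d
    have e2 := Real.cosh_sq d
    have e3 := Real.cosh_two_mul (1 / 2)
    have e4 := Real.cosh_sq (1 / 2)
    have e5 : 1 < Real.cosh (1 / 2) := Real.one_lt_cosh.2 (by norm_num)
    rw [show (2 : ℝ) * (1 / 2) = 1 by norm_num] at e3
    have e6 : Real.cosh 1 = 2 * Real.cosh (1 / 2) ^ 2 - 1 := by linarith
    rw [h1, e1, e6]
    have e7 : Real.cosh d ^ 2 + Real.sinh d ^ 2 = 2 * (Real.cosh (1 / 2) ^ 2) ^ 2 - 1 := by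
      rw [← h2.trans (sq _).symm]; linarith
    rw [e7]
    have e8 : 0 < Real.cosh (1 / 2) ^ 2 - 1 := by nlinarith
    nlinarith [mul_pos e8 e8]
  rw [Real.cosh_lt_cosh, abs_of_nonneg (by positivity), abs_of_nonneg dist_nonneg] at h3
  exact h3

lemma two_lt_dist_hexp_sq (p : UpperHalfPlane) {u v : Plane} (hu : ‖u‖ = 1) (hv : ‖v‖ = 1)
    (h : inner ℝ u v = 0) : 2 < dist (hexp p u) (hexp p v) ^ 2 := by
  have h1 := two_mul_dist_hexp_half_lt p hu hv h
  have h2 := norm_sub_le_dist_hexp p ((1 / 2 : ℝ) • u) ((1 / 2 : ℝ) • v)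
  have h3 := pow_le_pow_left₀ (norm_nonneg _) h2 2
  rw [norm_sub_sq_real, real_inner_smul_left, real_inner_smul_right, h, norm_smul, norm_smul, hu,
    hv, Real.norm_of_nonneg (by norm_num)] at h3
  have h4 := pow_lt_pow_left₀ h1 (by positivity) two_ne_zero
  nlinarith

/-! ### Unbounded curvature and four-point configurations -/

/-- A triangle of the hyperbolic plane, scaled by the factor `k`, has an area of order `k²`, but the
change of its comparison angle when the sides are halved does not depend on `k`. -/
theorem not_hasBoundedCurvature_L2H (o : UpperHalfPlane) : ¬ HasBoundedCurvature (L2H o) := by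
  intro H
  obtain ⟨ρ, hρ, μ, hμ, H⟩ := H (basePoint volume o)
  obtain ⟨u, v, hu, hv, huv⟩ := exists_orthonormal_plane
  set d := dist (hexp o ((1 / 2 : ℝ) • u)) (hexp o ((1 / 2 : ℝ) • v)) with hd
  set D := dist (hexp o u) (hexp o v) with hD
  have hlt : 2 * d < D := two_mul_dist_hexp_half_lt o hu hv huv
  have hd0 : 0 ≤ d := dist_nonneg
  have hD2 : D ≤ 2 := by
    have := dist_triangle_left (hexp o u) (hexp o v) o
    rw [dist_self_hexp, dist_self_hexp, hu, hv] at this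
    linarith
  set C := Real.arccos (1 - D ^ 2 / 2) - Real.arccos (1 - 2 * d ^ 2) with hC
  have hC0 : 0 < C := by
    have hsq : (2 * d) ^ 2 < D ^ 2 := pow_lt_pow_left₀ hlt (by positivity) two_ne_zero
    have := Real.arccos_lt_arccos (x := 1 - D ^ 2 / 2) (y := 1 - 2 * d ^ 2) (by nlinarith)
      (by nlinarith) (by nlinarith [sq_nonneg d])
    linarith
  have key : ∀ k : ℝ, 0 < k → k ≤ 1 → k < ρ → C ≤ μ * k ^ 2 := by
    intro k hk hk1 hkρ
    obtain ⟨f, hfo, hf⟩ := exists_scaled_copy o hk.le hk1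
    have hfv : ∀ (w : Plane), dist (f o) (f (hexp o w)) = k * ‖w‖ := fun w => by
      rw [hf, dist_self_hexp]
    have hhalf : ∀ w : Plane, ‖w‖ = 1 → dist (f o) (f (hexp o ((1 / 2 : ℝ) • w))) = k / 2 := by
      intro w hw
      rw [hfv, norm_smul, hw, Real.norm_of_nonneg (by norm_num)]; ring
    have hbetween : ∀ w : Plane, ‖w‖ = 1 →
        dist (f o) (f (hexp o ((1 / 2 : ℝ) • w))) +
          dist (f (hexp o ((1 / 2 : ℝ) • w))) (f (hexp o w)) = dist (f o) (f (hexp o w)) := by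
      intro w hw
      rw [hhalf w hw, hfv, hf, dist_hexp_smul o w (by norm_num) (by norm_num), hw]; ring
    have hne : ∀ a b : L2H o, 0 < dist a b → a ≠ b := fun a b h => dist_pos.1 h
    have hball : ∀ w : Plane, ‖w‖ = 1 → f (hexp o w) ∈ Metric.ball (basePoint volume o) ρ := by
      intro w hw
      rw [Metric.mem_ball', ← hfo, hfv, hw, mul_one]
      exact hkρ
    have h1 := H (f o) (by rw [hfo]; exact Metric.mem_ball_self hρ) (f (hexp o u)) (hball u hu)
      (f (hexp o v)) (hball v hv)
      (hne _ _ (by rw [hfv, hu]; linarith))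
      (hne _ _ (by rw [hf]; exact mul_pos hk (by linarith)))
      (hne _ _ (by rw [hfv, hv]; linarith))
      (f (hexp o ((1 / 2 : ℝ) • u))) (f (hexp o ((1 / 2 : ℝ) • v)))
      (hne _ _ (by rw [hhalf u hu]; positivity)).symm (hbetween u hu)
      (hne _ _ (by rw [hhalf v hv]; positivity)).symm (hbetween v hv)
    have a1 : compAngle (f o) (f (hexp o u)) (f (hexp o v)) = Real.arccos (1 - D ^ 2 / 2) := by
      rw [compAngle, hfv, hfv, hf, hu, hv, ← hD]
      congr 1; field_simp; ring
    have a2 : compAngle (f o) (f (hexp o ((1 / 2 : ℝ) • u))) (f (hexp o ((1 / 2 : ℝ) • v))) =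
        Real.arccos (1 - 2 * d ^ 2) := by
      rw [compAngle, hhalf u hu, hhalf v hv, hf, ← hd]
      congr 1; field_simp; ring
    have a3 : compArea (f o) (f (hexp o u)) (f (hexp o v)) ≤ k ^ 2 := by
      rw [compArea, hfv, hfv, hu, hv]
      have := Real.sin_le_one (compAngle (f o) (f (hexp o u)) (f (hexp o v)))
      nlinarith [sq_nonneg k, mul_le_mul_of_nonneg_left this (sq_nonneg k)]
    rw [a1, a2] at h1
    exact (le_abs_self _).trans (h1.trans (mul_le_mul_of_nonneg_left a3 hμ.le))
  have hlim : Tendsto (fun k : ℝ => μ * k ^ 2) (𝓝[>] 0) (𝓝 0) := by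
    have : Continuous fun k : ℝ => μ * k ^ 2 := by fun_prop
    have h := this.tendsto 0
    simp only [ne_eq, OfNat.ofNat_ne_zero, not_false_eq_true, zero_pow, mul_zero] at h
    exact h.mono_left nhdsWithin_le_nhds
  have := ge_of_tendsto hlim (b := C) (by
    filter_upwards [Ioo_mem_nhdsGT (show (0 : ℝ) < min 1 ρ from lt_min one_pos hρ)] with k hk
    exact key k hk.1 (hk.2.le.trans (min_le_left _ _)) (hk.2.trans_le (min_le_right _ _)))
  linarith

/-- At every scale, `L²([0,1], ℍ)` contains four points whose distances, up to scaling, are those of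
a fixed configuration that no Hilbert space contains. -/
lemma exists_four_points_L2H (o : UpperHalfPlane) : ∃ D : ℝ, 0 ≤ D ∧ 2 < D ^ 2 ∧
    ∀ k : ℝ, 0 < k → k ≤ 1 → ∃ a b c : L2H o, dist a (basePoint volume o) = k ∧
      dist b (basePoint volume o) = k ∧ dist c (basePoint volume o) = k ∧
      2 * k ≤ dist a b ∧ D * k ≤ dist a c ∧ D * k ≤ dist b c := by
  obtain ⟨u, v, hu, hv, huv⟩ := exists_orthonormal_plane
  refine ⟨dist (hexp o u) (hexp o v), dist_nonneg, two_lt_dist_hexp_sq o hu hv huv,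
    fun k hk hk1 => ?_⟩
  obtain ⟨f, hfo, hf⟩ := exists_scaled_copy o hk.le hk1
  have hneg : dist (hexp o (-u)) (hexp o v) = dist (hexp o u) (hexp o v) := by
    have h1 := cosh_dist_hexp_of_inner_eq_zero o (u := -u) (v := v)
      (by rw [inner_neg_left, huv]; simp)
    rw [norm_neg, ← cosh_dist_hexp_of_inner_eq_zero o huv] at h1
    exact eq_of_cosh_eq dist_nonneg dist_nonneg h1
  have hm : ∀ w : Plane, ‖w‖ = 1 → dist (f (hexp o w)) (basePoint volume o) = k := fun w hw => by
    rw [← hfo, hf, dist_comm, dist_self_hexp, hw, mul_one]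
  refine ⟨f (hexp o u), f (hexp o (-u)), f (hexp o v), hm u hu, hm (-u) (by rw [norm_neg, hu]),
    hm v hv, ?_, ?_, ?_⟩
  · have := norm_sub_le_dist_hexp o u (-u)
    rw [sub_neg_eq_add, ← two_smul ℝ u, norm_smul, hu] at this
    rw [hf, mul_comm]
    exact mul_le_mul_of_nonneg_left (by simpa using this) hk.le
  · rw [hf, mul_comm]
  · rw [hf, hneg, mul_comm]

end PythInt

end

theorem mainTheorem10 (o : UpperHalfPlane) :
    -- `L²([0,1], ℍ)` is a CAT(0) symmetric space
    PythInt.IsCAT0Symmetric (PythInt.L2H o) ∧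
    -- spaces of directions are integral joins
    (∀ x : PythInt.L2H o, Nonempty (PythInt.SpaceOfDirections x ≃ᵢ
      PythInt.IntegralJoin (volume : Measure unitInterval) (PythInt.SpaceOfDirections o))) ∧
    -- tangent cones are the Pythagorean integral of `T_o`
    (∀ x : PythInt.L2H o, Nonempty (PythInt.TangentCone x ≃ᵢ
      PythInt.PythagoreanIntegral (volume : Measure unitInterval)
        (PythInt.EuclideanCone.apex : PythInt.TangentCone o))) ∧
    -- `T_o` is a Euclidean plane, and through this identification `L²([0,1], T_o)` is a Hilbert space
    (∃ φ : PythInt.TangentCone o ≃ᵢ EuclideanSpace ℝ (Fin 2),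
      φ PythInt.EuclideanCone.apex = 0 ∧
      ∃ Φ : PythInt.PythagoreanIntegral (volume : Measure unitInterval)
          (PythInt.EuclideanCone.apex : PythInt.TangentCone o) ≃ᵢ
          Lp (EuclideanSpace ℝ (Fin 2)) 2 (volume : Measure unitInterval),
        ∀ f, ∀ᵐ t, (Φ f) t = φ (f.1 t)) ∧
    -- `L²([0,1], ℍ)` does not have bounded curvature
    ¬ PythInt.HasBoundedCurvature (PythInt.L2H o) ∧
    -- `L²([0,1], ℍ)` is not isometric to a smooth Riemannian manifold modelled on a Hilbert space
    ∀ (E : Type*) [NormedAddCommGroup E] [InnerProductSpace ℝ E] [CompleteSpace E]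
      (M : Type*) [EMetricSpace M] [ChartedSpace E M] [IsManifold 𝓘(ℝ, E) ∞ M]
      [Bundle.RiemannianBundle (fun x : M => TangentSpace 𝓘(ℝ, E) x)]
      [IsContMDiffRiemannianBundle 𝓘(ℝ, E) ∞ E (fun x : M => TangentSpace 𝓘(ℝ, E) x)]
      [IsRiemannianManifold 𝓘(ℝ, E) M],
      IsEmpty (PythInt.L2H o ≃ᵢ M) := by
  have ho := PythInt.isPolarChart_hexp o
  obtain ⟨Φ, hΦ⟩ := PythInt.exists_pythagoreanIntegral_equiv (μ := (volume : Measure unitInterval))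
    ho.tangentConeEquiv ho.tangentConeEquiv_apex
  refine ⟨PythInt.isCAT0Symmetric_pythagoreanIntegral, fun x => ?_, fun x => ?_,
    ⟨ho.tangentConeEquiv, ho.tangentConeEquiv_apex, Φ, hΦ⟩, PythInt.not_hasBoundedCurvature_L2H o,
    ?_⟩
  · exact ho.nonempty_direction_equiv_join (PythInt.isPolarChart_l2exp x)
  · exact ⟨(PythInt.isPolarChart_l2exp x).tangentConeEquiv.trans Φ.symm⟩
  · intro E _ _ _ M _ _ _ _ hM _
    have : IsContinuousRiemannianBundle E (fun x : M => TangentSpace 𝓘(ℝ, E) x) := by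
      obtain ⟨g, hg, h⟩ := hM.exists_contMDiff
      exact ⟨g, hg.continuous, h⟩
    obtain ⟨D, hD0, hD, H⟩ := PythInt.exists_four_points_L2H o
    exact PythInt.isEmpty_isometryEquiv_of_four_points E hD0 hD H
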